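/- \textbf{Definitions.} Let $\Omega=\{0,1\}^{\mathbb N}$ with the uniform measure $\lambda$; for a finite string $s$ let $[s]$ be the set of sequences with prefix $s$ (a basic set), and call a finite union of basic sets clopen. A \emph{partition refinement} $S$ of $\Omega$ is a partial function assigning to times $t\in\mathbb N$ and coordinates $x\in\{0,1\}^*$ nonempty sets (parts) $S^t(x)\subseteq\Omega$ such that: $S^0(\text{empty string})=\Omega$; if $S^t(x)$ is defined then $S^{t'}(x)=S^t(x)$ for all $t'>t$; and if one of $S^t(x0),S^t(x1)$ is defined, then so is the other, $t>0$, $S^{t-1}(x)$ is defined, and $\{S^t(x0),S^t(x1)\}$ is a partition of $S^t(x)$. A coordinate $x$ is \emph{terminal} at $t$ if $S^t(x)$ is defined and $S^t(x0),S^t(x1)$ are not; the part is \emph{split at} $t$ into $S^t(x0),S^t(x1)$ if $x$ is terminal at $t-1$ and these are defined. A \emph{betting strategy} is a pair $(S,\mu)$ of a partition refinement $S$ of $\Omega$ with clopen parts and a function $\mu:\{0,1\}^*\to[0,\infty)$ with $\mu(x)=\mu(x0)+\mu(x1)$ for all $x$. It is \emph{computable} if $S$ is partial computable (values given as finite lists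 of strings representing unions of basic sets) and the reals $\mu(x)$ are uniformly computable for those $x$ such that $S^t(x)$ is defined for some $t$. The capital of such an $x$ is $c(x)=\mu(x)/\lambda(S^t(x))$, and $\hat c(x)$ is the maximum of $c$ over the prefixes of $x$ (including $x$). The capital achieved on $\sigma\in\Omega$ up to time $t$ is $\hat c(x)$ for the coordinate $x$ terminal at $t$ with $\sigma\in S^t(x)$; the strategy \emph{wins} on $\sigma$ if this tends to $\infty$ as $t\to\infty$. A \emph{restriction} $\rho$ is a function from a set of positions (a subset of $\mathbb N$) to $\{0,1\}$; $[\rho]$ is the set of sequences that agree with $\rho$ on its domain. A part that is split at some time is \emph{split on} $\rho$ if both resulting parts intersect $[\rho]$; the number of times the part with coordinate $x$ \emph{was split on} $\rho$ is the number of proper prefixes $y$ of $x$ such that the part with coordinate $y$ is split on $\rho$. A betting strategy is \emph{half-splitting} if, for every $\rho$ that leaves only finitely many positions unrestricted, whenever a part is split on $\rho$, the two resulting parts contain the same number of elements of $[\rho]$. It is a \emph{Kolmogorov--Loveland (KL)} betting strategy if every part is of the form $[r]$ for some restriction $r$. Let $\pi=p_1,p_2,\dots$ be a sequence of distinct positions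 and $f:\mathbb N\to\mathbb Z$. A betting strategy \emph{on $\pi$ has splits upper bounded by $f$} if for $\lambda$-almost every $\sigma$, for all but finitely many $\ell$, every part containing $\sigma$ was split at most $f(\ell)$ times on the restriction that agrees with $\sigma$ on all positions except $p_1,\dots,p_\ell$ and leaves those unrestricted. A sequence is \emph{non-Martin-L\"of random} if it lies in $\bigcap_n U_n$ for some sets $U_n=\bigcup_k[f(n,k)]$ with $f:\mathbb N\times\mathbb N\to\{0,1\}^*$ computable, $\lambda(U_n)<2^{-n}$ and $U_{n+1}\subseteq U_n$ for all $n$. \textbf{Theorem.} Every KL betting strategy is half-splitting. Moreover, let $BS_A,BS_B$ be two computable half-splitting betting strategies, let $\pi$ be a computable sequence of distinct positions, and let $g:\mathbb N\to\mathbb N$ be an unbounded computable function. If both $BS_A$ and $BS_B$ on $\pi$ have splits upper bounded by $\ell-g(\ell)$, then there is a non-Martin-L\"of random sequence on which neither $BS_A$ nor $BS_B$ wins. -/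

import Mathlib

open MeasureTheory Filter Topology
open scoped NNReal ENNReal

/-- Infinite binary sequences. -/
abbrev BitSeq : Type := ℕ → Bool

/-- The uniform (Lebesgue, fair coin) measure on infinite binary sequences. -/
noncomputable def uniformMeasure : Measure BitSeq :=
  Measure.infinitePi fun _ : ℕ => (PMF.uniformOfFintype Bool).toMeasure

/-- The basic set of all infinite sequences that have the finite string `s` as a prefix. -/
def basicSet (s : List Bool) : Set BitSeq :=
  {σ | ∀ (i : ℕ) (b : Bool), s[i]? = some b → σ i = b}

/-! ### Martin-Löf randomness -/

/-- The `n`-th level of a family of strings: the union over `k` of the basic sets of `f n k`. -/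
def testLevel (f : ℕ → ℕ → List Bool) (n : ℕ) : Set BitSeq :=
  ⋃ k : ℕ, basicSet (f n k)

/-- Martin-Löf tests. -/
structure IsMLTest (f : ℕ → ℕ → List Bool) : Prop where
  computable : Computable₂ f
  size_lt : ∀ n, uniformMeasure (testLevel f n) < (2⁻¹ : ℝ≥0∞) ^ n
  antitone : ∀ n, testLevel f (n + 1) ⊆ testLevel f n

/-- A sequence is Martin-Löf random if no Martin-Löf test contains it in all of its levels. -/
def IsMartinLofRandom (σ : BitSeq) : Prop :=
  ¬ ∃ f : ℕ → ℕ → List Bool, IsMLTest f ∧ ∀ n, σ ∈ testLevel f n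

/-! ### Restrictions -/

/-- A restriction is a map from a set of positions to bits; `none` marks unrestricted positions. -/
abbrev BitRestriction : Type := ℕ → Option Bool

/-- The set of sequences consistent with a restriction. -/
def BitRestriction.consistent (r : BitRestriction) : Set BitSeq :=
  {σ | ∀ (p : ℕ) (b : Bool), r p = some b → σ p = b}

/-- The set of positions that the restriction leaves unrestricted. -/
def BitRestriction.unrestricted (r : BitRestriction) : Set ℕ :=
  {p | r p = none}

/-- The restriction that agrees with `σ` and restricts all positions except the first `ℓ` members
`π 0, …, π (ℓ - 1)` of the sequence of positions `π`. -/
def tailRestriction (π : ℕ → ℕ) (ℓ : ℕ) (σ : BitSeq) : BitRestriction :=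
  fun p => if p ∈ (Finset.range ℓ).image π then none else some (σ p)

/-! ### Partition refinements -/

/-- A partition refinement of `Ω`. The coordinates are finite binary strings, and the string `x`
followed by the bit `b` is `x ++ [b]`. -/
structure PartitionRefinement (Ω : Type*) where
  /-- The partial function `S`: the part `S^t(x)` at time `t` with the coordinate `x`. -/
  part : ℕ → List Bool → Part (Set Ω)
  nonempty : ∀ t x v, v ∈ part t x → v.Nonempty
  root : Set.univ ∈ part 0 []
  stable : ∀ t t' x v, t < t' → v ∈ part t x → v ∈ part t' x
  split_dom : ∀ t x b, (part t (x ++ [b])).Dom →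
    0 < t ∧ (part (t - 1) x).Dom ∧ (part t (x ++ [!b])).Dom
  split_partition : ∀ t x v v₀ v₁, v ∈ part t x → v₀ ∈ part t (x ++ [false]) →
    v₁ ∈ part t (x ++ [true]) → v₀ ∪ v₁ = v ∧ Disjoint v₀ v₁

namespace PartitionRefinement

variable {Ω : Type*} (S : PartitionRefinement Ω)

/-- The coordinate `x` is terminal at time `t`. -/
def IsTerminal (t : ℕ) (x : List Bool) : Prop :=
  (S.part t x).Dom ∧ ∀ b, ¬ (S.part t (x ++ [b])).Dom

/-- The part with the coordinate `x` is split at time `t` into the parts `v₀` and `v₁`. -/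
def SplitsInto (t : ℕ) (x : List Bool) (v₀ v₁ : Set Ω) : Prop :=
  0 < t ∧ S.IsTerminal (t - 1) x ∧ v₀ ∈ S.part t (x ++ [false]) ∧ v₁ ∈ S.part t (x ++ [true])

/-- The eventual part with the coordinate `x`: it is the common value of all defined `S^t(x)`, and
it is empty if `S^t(x)` is undefined for all `t`. -/
def eventualPart (x : List Bool) : Set Ω :=
  {ω | ∃ t, ∃ v ∈ S.part t x, ω ∈ v}

end PartitionRefinement

/-- The part with the coordinate `x` is split on the restriction `ρ` at time `t`, into `v₀` and
`v₁`: both of these contain sequences consistent with `ρ`. -/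
def PartitionRefinement.SplitsOnInto (S : PartitionRefinement BitSeq) (ρ : BitRestriction)
    (t : ℕ) (x : List Bool) (v₀ v₁ : Set BitSeq) : Prop :=
  S.SplitsInto t x v₀ v₁ ∧ (v₀ ∩ ρ.consistent).Nonempty ∧ (v₁ ∩ ρ.consistent).Nonempty

/-- The number of times that the part with the coordinate `x` was split on `ρ` up to time `t`: the
number of proper prefixes `y` of `x` such that the part with the coordinate `y` was split on `ρ`. -/
noncomputable def PartitionRefinement.numSplitsOn (S : PartitionRefinement BitSeq)
    (ρ : BitRestriction) (t : ℕ) (x : List Bool) : ℕ :=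
  {y : List Bool | y <+: x ∧ y ≠ x ∧ ∃ t' ≤ t, ∃ v₀ v₁, S.SplitsOnInto ρ t' y v₀ v₁}.ncard

/-- A partition refinement of `BitSeq` is computable if it is a partial computable function, its
values being presented as finite unions of basic sets, that is, by finite lists of strings. -/
def PartitionRefinement.IsComputable (S : PartitionRefinement BitSeq) : Prop :=
  ∃ F : ℕ → List Bool →. List (List Bool), Partrec₂ F ∧
    ∀ t x, S.part t x = (F t x).map fun C => {σ : BitSeq | ∃ s ∈ C, σ ∈ basicSet s}

/-! ### Betting strategies -/

/-- A mass function on finite strings. -/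
structure MassFunction where
  toFun : List Bool → ℝ≥0
  additive : ∀ x, toFun x = toFun (x ++ [false]) + toFun (x ++ [true])

/-- A (general) betting strategy: a partition refinement of the set of infinite binary sequences
into clopen parts, together with a mass function. -/
structure BettingStrategy where
  S : PartitionRefinement BitSeq
  isClopen : ∀ t x v, v ∈ S.part t x → IsClopen v
  μ : MassFunction

namespace BettingStrategy

variable (B : BettingStrategy)

/-- The betting strategy is computable: the partition refinement is computable, and the masses of
the coordinates whose part is ever defined are uniformly computable reals. (`q x n` is the
numerator of an approximation of the mass of `x` with denominator `2 ^ n` and error at most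
`2⁻ⁿ`; it may diverge if `x` never becomes the coordinate of a part.) -/
def IsComputable : Prop :=
  B.S.IsComputable ∧
    ∃ q : List Bool → ℕ →. ℕ, Partrec₂ q ∧
      ∀ t x, (B.S.part t x).Dom → ∀ n, ∃ k ∈ q x n,
        |(k : ℝ) / 2 ^ n - (B.μ.toFun x : ℝ)| ≤ 1 / 2 ^ n

/-- The capital of a coordinate: its mass divided by the size of its part. -/
noncomputable def capital (x : List Bool) : ℝ≥0 :=
  B.μ.toFun x / (uniformMeasure (B.S.eventualPart x)).toNNReal

/-- The maximum capital of a coordinate: the maximum of the capital over all its prefixes. -/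
noncomputable def maxCapital (x : List Bool) : ℝ≥0 :=
  x.inits.toFinset.sup B.capital

/-- The capital achieved on `σ` up to time `t`: the maximum capital of the unique coordinate that is
terminal at `t` and whose part contains `σ`. -/
noncomputable def achievedCapital (t : ℕ) (σ : BitSeq) : ℝ≥0∞ :=
  ⨆ (x : List Bool) (_ : B.S.IsTerminal t x ∧ ∃ v ∈ B.S.part t x, σ ∈ v), (B.maxCapital x : ℝ≥0∞)

/-- The betting strategy wins on `σ`: its achieved capital on `σ` is unlimited. -/
def Wins (σ : BitSeq) : Prop :=
  Tendsto (fun t => B.achievedCapital t σ) atTop (𝓝 ⊤)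

/-- Kolmogorov-Loveland betting strategies: every part is the set of the sequences that are
consistent with some restriction. -/
def IsKolmogorovLoveland : Prop :=
  ∀ t x v, v ∈ B.S.part t x → ∃ r : BitRestriction, v = r.consistent

/-- Half-splitting betting strategies: for every restriction `ρ` with finitely many unrestricted
positions, whenever a part is split on `ρ`, the two resulting parts contain the same number of
sequences consistent with `ρ`. -/
def IsHalfSplitting : Prop :=
  ∀ ρ : BitRestriction, ρ.unrestricted.Finite → ∀ t x v₀ v₁, B.S.SplitsOnInto ρ t x v₀ v₁ →
    (v₀ ∩ ρ.consistent).ncard = (v₁ ∩ ρ.consistent).ncard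

/-- On the sequence of positions `π` the betting strategy has splits upper bounded by `f`: for
almost every `σ`, for all but finitely many `ℓ`, every part that contains `σ` was split at most
`f ℓ` times on the restriction of `σ` to all positions except the first `ℓ` positions of `π`. -/
def SplitsUpperBounded (π : ℕ → ℕ) (f : ℕ → ℤ) : Prop :=
  ∀ᵐ σ ∂uniformMeasure, ∀ᶠ ℓ : ℕ in atTop, ∀ t x v, v ∈ B.S.part t x → σ ∈ v →
    (B.S.numSplitsOn (tailRestriction π ℓ σ) t x : ℤ) ≤ f ℓ

end BettingStrategy

/-! The two halves of a KL split are disjoint, so their restrictions disagree at some position.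
Flipping that bit maps each half injectively into the other inside every `[ρ]` that meets both.

For the main statement, let the fiber of `σ` at `ℓ` be the `2 ^ ℓ` sequences that differ from `σ`
only at the first `ℓ` positions of `π`. If a part of a half-splitting strategy meets the fiber and
was split `s` times on it, the part contains exactly `2 ^ (ℓ - s)` of its elements
(`fiberCard_mul_numSplitsOn`). The bound on splits thus says that almost surely, for all large `ℓ`,
every part around `σ` keeps at least `2 ^ g ℓ` elements of the fiber. Together with Ville's
inequality, this yields a sequence around which the parts of both strategies stay large and the
capital stays bounded (`exists_forall_le_fiberCard`).

Call a sequence killed at level `i` if some part containing it has large approximate capital, or has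
fewer than `2 ^ g ℓ` elements of the fiber for the `ℓ` of some level from `i` on. Killing is
enumerable. With `e = g ℓ - 1` at level `i`, a part with fewer than `2 ^ e` elements in the fiber
may be exempted from killing: when sizes halve they pass through `2 ^ e`, and an ancestor of that
size is already too small and kills (`mem_safeSet_iff`). The parts of one strategy are nested or
disjoint and their sizes in the fiber are powers of two, so the number of elements that one strategy
kills in a fiber is always a multiple of `2 ^ e`.

In each fiber, follow the first element that extends a given string and is not yet killed. Every
change of this survivor adds at least `2 ^ e` killed elements for one of the two strategies, so
there are at most `2 * 2 ^ (ℓ - e) + 1` survivors in a fiber. Averaging over fibers, the open set of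
all survivors has measure at most `3 / 2 ^ e` (`measure_survivorSet_le`), small enough for a
Martin-Löf test.

A fiber that contains a never-killed extension of the string has a survivor that is never killed.
Hence the tail unions of survivor sets, taken over all strings, are dense in the closure of the
never-killed sequences, and Baire's theorem gives a point of the closure in infinitely many of them
(`exists_mem_closure_frequently`). This point is not random. Parts are open, so every part around it
also contains a never-killed sequence and has bounded capital. -/

/-! ### Elementary properties of partition refinements -/

namespace PartitionRefinement

variable {Ω : Type*} (S : PartitionRefinement Ω)

theorem mem_part_of_le {t t' : ℕ} {x : List Bool} {v : Set Ω} (h : t ≤ t')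
    (hv : v ∈ S.part t x) : v ∈ S.part t' x := by
  rcases h.eq_or_lt with rfl | h
  · exact hv
  · exact S.stable _ _ _ _ h hv

theorem part_unique {t t' : ℕ} {x : List Bool} {v v' : Set Ω} (hv : v ∈ S.part t x)
    (hv' : v' ∈ S.part t' x) : v = v' :=
  Part.mem_unique (S.mem_part_of_le (le_max_left t t') hv)
    (S.mem_part_of_le (le_max_right t t') hv')

theorem eventualPart_eq {t : ℕ} {x : List Bool} {v : Set Ω} (hv : v ∈ S.part t x) :
    S.eventualPart x = v := by
  ext ω
  constructor
  · rintro ⟨t', v', hv', hω⟩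
    rwa [S.part_unique hv hv']
  · exact fun hω => ⟨t, v, hv, hω⟩

theorem exists_parent {t : ℕ} {x : List Bool} {b : Bool} {v : Set Ω}
    (hv : v ∈ S.part t (x ++ [b])) : ∃ u ∈ S.part t x, ∃ w ∈ S.part t (x ++ [!b]),
      v ∪ w = u ∧ Disjoint v w := by
  obtain ⟨h0, h1, h2⟩ := S.split_dom t x b (Part.dom_iff_mem.2 ⟨v, hv⟩)
  obtain ⟨u, hu⟩ := Part.dom_iff_mem.1 h1
  obtain ⟨w, hw⟩ := Part.dom_iff_mem.1 h2
  have hu' := S.mem_part_of_le (Nat.sub_le t 1) hu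
  refine ⟨u, hu', w, hw, ?_⟩
  cases b
  · exact S.split_partition t x u v w hu' hv hw
  · obtain ⟨h3, h4⟩ := S.split_partition t x u w v hu' hw hv
    exact ⟨by rw [Set.union_comm, h3], h4.symm⟩

theorem SplitsInto.partition {S : PartitionRefinement Ω} {t : ℕ} {x : List Bool} {v₀ v₁ : Set Ω}
    (h : S.SplitsInto t x v₀ v₁) :
    ∃ v ∈ S.part t x, v₀ ∪ v₁ = v ∧ Disjoint v₀ v₁ := by
  obtain ⟨u, hu, w, hw, h1, h2⟩ := S.exists_parent h.2.2.1
  have : w = v₁ := S.part_unique hw h.2.2.2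
  subst this
  exact ⟨u, hu, h1, h2⟩

end PartitionRefinement

/-! ### KL strategies are half-splitting -/

namespace BitRestriction

/-- Without a separating position, overwriting a member of `[r₀]` by the values of `r₁` would give a
common member. -/
theorem exists_separating_position {r₀ r₁ : BitRestriction} (h₀ : r₀.consistent.Nonempty)
    (hd : Disjoint r₀.consistent r₁.consistent) :
    ∃ p b, r₀ p = some b ∧ r₁ p = some (!b) := by
  by_contra! hcon
  obtain ⟨σ, hσ⟩ := h₀
  let τ : BitSeq := fun p => (r₁ p).getD (σ p)
  refine Set.disjoint_left.1 hd (show τ ∈ r₀.consistent from ?_) ?_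
  · intro p b hb
    have hσp := hσ p b hb
    have hne := hcon p b hb
    change (r₁ p).getD (σ p) = b
    cases hr : r₁ p with
    | none => simpa using hσp
    | some c =>
      rw [hr] at hne
      simp only [Option.getD_some]
      simpa using hne
  · intro p b hb
    simp [τ, hb]

theorem update_mem_consistent {r : BitRestriction} {σ : BitSeq} (hσ : σ ∈ r.consistent) {p : ℕ}
    (hp : r p = none) (b : Bool) : Function.update σ p b ∈ r.consistent := by
  intro q c hq
  have : q ≠ p := by rintro rfl; simp [hp] at hq
  rw [Function.update_of_ne this]
  exact hσ q c hq

theorem eq_none_of_mem {r : BitRestriction} {σ τ : BitSeq} (hσ : σ ∈ r.consistent)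
    (hτ : τ ∈ r.consistent) {p : ℕ} (h : σ p ≠ τ p) : r p = none := by
  cases hr : r p with
  | none => rfl
  | some b => exact absurd ((hσ p b hr).trans (hτ p b hr).symm) h

theorem image_flip_subset {r r₀ r₁ ρ : BitRestriction}
    (hu : r₀.consistent ∪ r₁.consistent = r.consistent) {p : ℕ} {b : Bool}
    (hp₀ : r₀ p = some b) (hr : r p = none) (hρ : ρ p = none) :
    (fun σ : BitSeq => Function.update σ p (!b)) '' (r₀.consistent ∩ ρ.consistent) ⊆
      r₁.consistent ∩ ρ.consistent := by
  rintro _ ⟨σ, ⟨h0, h1⟩, rfl⟩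
  refine ⟨?_, update_mem_consistent h1 hρ _⟩
  have h2 : Function.update σ p (!b) ∈ r.consistent :=
    update_mem_consistent (hu ▸ Or.inl h0) hr _
  rw [← hu] at h2
  refine h2.resolve_left fun h3 => ?_
  have := h3 p b hp₀
  simp at this

theorem injOn_flip {r₀ : BitRestriction} {p : ℕ} {b c : Bool} (hp₀ : r₀ p = some b) :
    Set.InjOn (fun σ : BitSeq => Function.update σ p c) r₀.consistent := by
  intro σ hσ τ hτ h
  ext q
  by_cases hq : q = p
  · subst hq
    rw [hσ q b hp₀, hτ q b hp₀]
  · simpa [Function.update_of_ne hq] using congrFun h q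

/-- Members of both halves in `[ρ]` differ at the separating position, so neither `r` nor `ρ`
restricts it. Flipping it injects each half into the other. The comparison is made in `encard`, so
`[ρ]` need not be finite. -/
theorem ncard_inter_eq {r r₀ r₁ ρ : BitRestriction}
    (hu : r₀.consistent ∪ r₁.consistent = r.consistent)
    (hd : Disjoint r₀.consistent r₁.consistent)
    (h₀ : (r₀.consistent ∩ ρ.consistent).Nonempty) (h₁ : (r₁.consistent ∩ ρ.consistent).Nonempty) :
    (r₀.consistent ∩ ρ.consistent).ncard = (r₁.consistent ∩ ρ.consistent).ncard := by
  obtain ⟨p, b, hp₀, hp₁⟩ := exists_separating_position h₀.left hd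
  obtain ⟨σ₀, hσ₀, hρ₀⟩ := h₀
  obtain ⟨σ₁, hσ₁, hρ₁⟩ := h₁
  have hne : σ₀ p ≠ σ₁ p := by
    rw [hσ₀ p b hp₀, hσ₁ p _ hp₁]; cases b <;> simp
  have hr : r p = none := eq_none_of_mem (hu ▸ Or.inl hσ₀) (hu ▸ Or.inr hσ₁) hne
  have hρ : ρ p = none := eq_none_of_mem hρ₀ hρ₁ hne
  have e₀₁ := image_flip_subset hu hp₀ hr hρ
  have e₁₀ := image_flip_subset (r₀ := r₁) (r₁ := r₀) (by rw [Set.union_comm]; exact hu) hp₁ hr hρ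
  have i₀ := (injOn_flip (c := !b) hp₀).mono (Set.inter_subset_left (t := ρ.consistent))
  have i₁ := (injOn_flip (c := !!b) hp₁).mono (Set.inter_subset_left (t := ρ.consistent))
  have c₀₁ := Set.encard_le_encard e₀₁
  have c₁₀ := Set.encard_le_encard e₁₀
  rw [i₀.encard_image] at c₀₁
  rw [i₁.encard_image] at c₁₀
  simp only [Set.ncard, le_antisymm c₀₁ c₁₀]

end BitRestriction

theorem BettingStrategy.IsKolmogorovLoveland.isHalfSplitting {B : BettingStrategy}
    (hB : B.IsKolmogorovLoveland) : B.IsHalfSplitting := by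
  rintro ρ - t x v₀ v₁ ⟨hs, h₀, h₁⟩
  obtain ⟨v, hv, hu, hd⟩ := hs.partition
  obtain ⟨r, rfl⟩ := hB _ _ _ hv
  obtain ⟨r₀, rfl⟩ := hB _ _ _ hs.2.2.1
  obtain ⟨r₁, rfl⟩ := hB _ _ _ hs.2.2.2
  exact BitRestriction.ncard_inter_eq hu hd h₀ h₁

/-! ### Fibers of finitely many positions -/

section Fiber

variable {α β : Type*}

/-- The list of all variants of `a` in which the positions in `P` get arbitrary values. -/
def fiberList (upd : α → ℕ → Bool → α) : List ℕ → α → List α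
  | [], a => [a]
  | p :: P, a => fiberList upd P (upd a p false) ++ fiberList upd P (upd a p true)

/-- Some string of the list is a prefix of `a`, prefixes being recognized by `pre`. -/
def coverTest (pre : List Bool → α → Bool) (C : List (List Bool)) (a : α) : Bool :=
  C.any fun c => pre c a

/-- The number of elements of the fiber of `a` that are covered by `C`. -/
def fiberCount (upd : α → ℕ → Bool → α) (pre : List Bool → α → Bool) (P : List ℕ)
    (C : List (List Bool)) (a : α) : ℕ :=
  ((fiberList upd P a).filter (coverTest pre C)).length

/-- A kill event `(C, Q, n)` concerns those elements covered by `C` for which `C` covers fewer than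
`n` elements of the fiber of `Q`. -/
abbrev KillEvent : Type := List (List Bool) × List ℕ × ℕ

/-- The event `e` kills `a`, where parts with fewer than `m` elements in the fiber are exempt. -/
def hits (upd : α → ℕ → Bool → α) (pre : List Bool → α → Bool) (P : List ℕ) (m : ℕ)
    (e : KillEvent) (a : α) : Bool :=
  coverTest pre e.1 a && (decide (fiberCount upd pre e.2.1 e.1 a < e.2.2) &&
    decide (m ≤ fiberCount upd pre P e.1 a))

/-- Some event in the list `D` kills `a`. -/
def killed (upd : α → ℕ → Bool → α) (pre : List Bool → α → Bool) (P : List ℕ) (m : ℕ)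
    (D : List KillEvent) (a : α) : Bool :=
  D.any fun e => hits upd pre P m e a

/-- The first element of the fiber of `a` that extends `s` and is not killed. -/
def survivor (upd : α → ℕ → Bool → α) (pre : List Bool → α → Bool) (P : List ℕ) (m : ℕ)
    (D : List KillEvent) (s : List Bool) (a : α) : Option α :=
  (fiberList upd P a).find? fun b => pre s b && !killed upd pre P m D b

theorem length_fiberList (upd : α → ℕ → Bool → α) (P : List ℕ) (a : α) :
    (fiberList upd P a).length = 2 ^ P.length := by
  induction P generalizing a with
  | nil => rfl
  | cons p P ih => simp [fiberList, ih, pow_succ, mul_two]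

variable {upd : α → ℕ → Bool → α} {upd' : β → ℕ → Bool → β}
  {pre : List Bool → α → Bool} {pre' : List Bool → β → Bool} {φ : α → β}

/-- The carrier is generic because sequences carry the measure argument and strings the computation.
A map that commutes with updates transfers all notions between them. -/
theorem fiberList_map (hφ : ∀ a p b, φ (upd a p b) = upd' (φ a) p b) (P : List ℕ) (a : α) :
    fiberList upd' P (φ a) = (fiberList upd P a).map φ := by
  induction P generalizing a with
  | nil => rfl
  | cons p P ih => simp [fiberList, ← hφ, ih]

theorem coverTest_map {C : List (List Bool)} (hp : ∀ c ∈ C, ∀ a, pre' c (φ a) = pre c a) (a : α) :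
    coverTest pre' C (φ a) = coverTest pre C a := by
  rw [Bool.eq_iff_iff]
  simp only [coverTest, List.any_eq_true]
  exact exists_congr fun c => and_congr_right fun hc => by rw [hp c hc]

theorem fiberCount_map (hφ : ∀ a p b, φ (upd a p b) = upd' (φ a) p b) (P : List ℕ)
    {C : List (List Bool)} (hp : ∀ c ∈ C, ∀ a, pre' c (φ a) = pre c a) (a : α) :
    fiberCount upd' pre' P C (φ a) = fiberCount upd pre P C a := by
  have : coverTest pre' C ∘ φ = coverTest pre C := funext fun a => coverTest_map hp a
  rw [fiberCount, fiberList_map hφ, List.filter_map, List.length_map, this, fiberCount]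

theorem killed_map (hφ : ∀ a p b, φ (upd a p b) = upd' (φ a) p b) (P : List ℕ) (m : ℕ)
    {D : List KillEvent} (hp : ∀ e ∈ D, ∀ c ∈ e.1, ∀ a, pre' c (φ a) = pre c a) (a : α) :
    killed upd' pre' P m D (φ a) = killed upd pre P m D a := by
  rw [Bool.eq_iff_iff]
  simp only [killed, List.any_eq_true]
  refine exists_congr fun e => and_congr_right fun he => ?_
  rw [hits, coverTest_map (hp e he), fiberCount_map hφ _ (hp e he), fiberCount_map hφ _ (hp e he),
    hits]

theorem survivor_map (hφ : ∀ a p b, φ (upd a p b) = upd' (φ a) p b) (P : List ℕ) (m : ℕ)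
    {D : List KillEvent} (hp : ∀ e ∈ D, ∀ c ∈ e.1, ∀ a, pre' c (φ a) = pre c a) {s : List Bool}
    (hs : ∀ a, pre' s (φ a) = pre s a) (a : α) :
    survivor upd' pre' P m D s (φ a) = (survivor upd pre P m D s a).map φ := by
  rw [survivor, fiberList_map hφ, List.find?_map, survivor]
  congr 2
  funext b
  simp [hs, killed_map hφ P m hp]

end Fiber

/-! ### Fibers of infinite sequences -/

section SeqFiber

open Classical in
/-- The string `s` is a prefix of `σ`. -/
noncomputable def seqPrefix (s : List Bool) (σ : BitSeq) : Bool := decide (σ ∈ basicSet s)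

/-- Overwriting a bit of a sequence. -/
def seqUpdate (σ : BitSeq) (p : ℕ) (b : Bool) : BitSeq := Function.update σ p b

/-- The finite union of basic sets given by a list of strings. -/
def listSet (C : List (List Bool)) : Set BitSeq := {σ | ∃ s ∈ C, σ ∈ basicSet s}

/-- The list of the sequences that agree with `σ` on all positions not in `P`. -/
def seqFiber (P : List ℕ) (σ : BitSeq) : List BitSeq := fiberList seqUpdate P σ

@[simp] theorem seqPrefix_eq_true {s : List Bool} {σ : BitSeq} :
    seqPrefix s σ = true ↔ σ ∈ basicSet s := by simp [seqPrefix]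

theorem coverTest_seqPrefix {C : List (List Bool)} {σ : BitSeq} :
    coverTest seqPrefix C σ = true ↔ σ ∈ listSet C := by
  simp [coverTest, listSet]

theorem mem_seqFiber {P : List ℕ} {σ τ : BitSeq} :
    τ ∈ seqFiber P σ ↔ ∀ q, q ∉ P → τ q = σ q := by
  unfold seqFiber
  induction P generalizing σ with
  | nil => simp [fiberList, funext_iff]
  | cons p P ih =>
    simp only [fiberList, List.mem_append, ih, seqUpdate, List.mem_cons, not_or, and_imp]
    constructor
    · rintro (h | h) q hq hqP <;> simpa [Function.update_of_ne hq] using h q hqP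
    · intro h
      have key : ∀ q, q ∉ P → τ q = Function.update σ p (τ p) q := by
        intro q hq
        by_cases hqp : q = p
        · subst hqp; simp
        · rw [Function.update_of_ne hqp]; exact h q hqp hq
      cases hb : τ p <;> rw [hb] at key
      · exact Or.inl key
      · exact Or.inr key

theorem self_mem_seqFiber (P : List ℕ) (σ : BitSeq) : σ ∈ seqFiber P σ :=
  mem_seqFiber.2 fun _ _ => rfl

/-- The lists agree including their order, since the recursion overwrites every position in `P`. So
the first survivor depends on the fiber only. -/
theorem seqFiber_congr {P : List ℕ} {σ τ : BitSeq} (h : τ ∈ seqFiber P σ) :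
    seqFiber P τ = seqFiber P σ := by
  rw [mem_seqFiber] at h
  unfold seqFiber
  induction P generalizing σ τ with
  | nil => rw [show τ = σ from funext fun q => h q (by simp)]
  | cons p P ih =>
    have key : ∀ b, ∀ q, q ∉ P → Function.update τ p b q = Function.update σ p b q := by
      intro b q hq
      by_cases hqp : q = p
      · subst hqp; simp
      · rw [Function.update_of_ne hqp, Function.update_of_ne hqp]
        exact h q (by simp [hqp, hq])
    simp only [fiberList, seqUpdate]
    rw [ih (key false), ih (key true)]

theorem nodup_seqFiber {P : List ℕ} (hP : P.Nodup) (σ : BitSeq) : (seqFiber P σ).Nodup := by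
  induction P generalizing σ with
  | nil => simp [seqFiber, fiberList]
  | cons p P ih =>
    obtain ⟨hp, hP⟩ := List.nodup_cons.1 hP
    change (seqFiber P _ ++ seqFiber P _).Nodup
    rw [List.nodup_append]
    refine ⟨ih hP _, ih hP _, fun a ha b hb hab => ?_⟩
    have h1 := mem_seqFiber.1 ha p hp
    have h2 := mem_seqFiber.1 hb p hp
    simp [seqUpdate] at h1 h2
    simp [hab, h2] at h1

theorem fiberCount_congr {P : List ℕ} {C : List (List Bool)} {σ τ : BitSeq}
    (h : τ ∈ seqFiber P σ) :
    fiberCount seqUpdate seqPrefix P C τ = fiberCount seqUpdate seqPrefix P C σ := by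
  have := seqFiber_congr h
  rw [seqFiber, seqFiber] at this
  rw [fiberCount, fiberCount, this]

theorem survivor_congr {P : List ℕ} {m : ℕ} {D : List KillEvent} {s : List Bool} {σ τ : BitSeq}
    (h : τ ∈ seqFiber P σ) :
    survivor seqUpdate seqPrefix P m D s τ = survivor seqUpdate seqPrefix P m D s σ := by
  have := seqFiber_congr h
  rw [seqFiber, seqFiber] at this
  rw [survivor, survivor, this]

theorem seqFiber_mono {P Q : List ℕ} (hQ : P ⊆ Q) {σ τ : BitSeq} (h : τ ∈ seqFiber P σ) :
    τ ∈ seqFiber Q σ :=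
  mem_seqFiber.2 fun q hq => mem_seqFiber.1 h q fun hqP => hq (hQ hqP)

open Classical in
theorem fiberCount_eq_card {P : List ℕ} (hP : P.Nodup) (C : List (List Bool)) (σ : BitSeq) :
    fiberCount seqUpdate seqPrefix P C σ =
      ((seqFiber P σ).toFinset.filter (· ∈ listSet C)).card := by
  change ((seqFiber P σ).filter _).length = _
  rw [← List.toFinset_card_of_nodup ((nodup_seqFiber hP σ).filter _)]
  congr 1
  ext τ
  simp [coverTest_seqPrefix]

end SeqFiber

/-! ### Averaging over fibers -/

section Measure

instance : IsProbabilityMeasure uniformMeasure := by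
  unfold uniformMeasure; infer_instance

/-- Flipping the bit at position `p`. -/
def flipAt (p : ℕ) (σ : BitSeq) : BitSeq := fun q => if q = p then !σ q else σ q

theorem map_not_uniform : (PMF.uniformOfFintype Bool).toMeasure.map Bool.not =
    (PMF.uniformOfFintype Bool).toMeasure := by
  rw [PMF.toMeasure_map _ _ (measurable_of_countable _)]
  congr 1
  ext b
  rw [PMF.map_apply, tsum_bool]
  cases b <;> simp

theorem measurePreserving_flipAt (p : ℕ) :
    MeasurePreserving (flipAt p) uniformMeasure uniformMeasure := by
  have hm : ∀ q : ℕ, Measurable (fun b : Bool => if q = p then !b else b) :=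
    fun q => measurable_of_countable _
  refine ⟨measurable_pi_iff.2 fun q => (hm q).comp (measurable_pi_apply q), ?_⟩
  have := Measure.infinitePi_map_pi (fun _ : ℕ => (PMF.uniformOfFintype Bool).toMeasure) hm
  unfold uniformMeasure
  refine Eq.trans this ?_
  congr 1
  funext q
  by_cases hq : q = p
  · simp only [hq, if_true]; exact map_not_uniform
  · simp only [hq, if_false]; exact Measure.map_id

/-- The two updates are, in some order, `σ` and its flip at `p`, and flipping preserves the measure.
-/
theorem lintegral_update_add {h : BitSeq → ℝ≥0∞} (hh : Measurable h) (p : ℕ) :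
    ∫⁻ σ, (h (seqUpdate σ p false) + h (seqUpdate σ p true)) ∂uniformMeasure =
      2 * ∫⁻ σ, h σ ∂uniformMeasure := by
  have : ∀ σ, h (seqUpdate σ p false) + h (seqUpdate σ p true) = h σ + h (flipAt p σ) := by
    intro σ
    have h1 : seqUpdate σ p (σ p) = σ := Function.update_eq_self p σ
    have h2 : seqUpdate σ p (!σ p) = flipAt p σ := by
      funext q
      by_cases hq : q = p
      · subst hq; simp [seqUpdate, flipAt]
      · simp [seqUpdate, flipAt, hq]
    cases hb : σ p <;> rw [hb] at h1 h2
    · rw [h1]; rw [Bool.not_false] at h2; rw [h2]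
    · rw [h1]; rw [Bool.not_true] at h2; rw [h2, add_comm]
  simp_rw [this]
  rw [lintegral_add_left hh, (measurePreserving_flipAt p).lintegral_comp hh, two_mul]

theorem measurable_seqUpdate (p : ℕ) (b : Bool) : Measurable fun σ => seqUpdate σ p b :=
  measurable_pi_iff.2 fun q => by
    by_cases hq : q = p
    · subst hq; simp [seqUpdate]
    · simpa [seqUpdate, hq] using measurable_pi_apply q

theorem lintegral_sum_seqFiber {h : BitSeq → ℝ≥0∞} (hh : Measurable h) (P : List ℕ) :
    Measurable (fun σ => ((seqFiber P σ).map h).sum) ∧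
    ∫⁻ σ, ((seqFiber P σ).map h).sum ∂uniformMeasure =
      2 ^ P.length * ∫⁻ σ, h σ ∂uniformMeasure := by
  induction P with
  | nil => simp [seqFiber, fiberList, hh]
  | cons p P ih =>
    have : ∀ σ, ((seqFiber (p :: P) σ).map h).sum =
        ((seqFiber P (seqUpdate σ p false)).map h).sum +
        ((seqFiber P (seqUpdate σ p true)).map h).sum := by
      intro σ; simp [seqFiber, fiberList]
    simp_rw [this]
    refine ⟨(ih.1.comp (measurable_seqUpdate _ _)).add (ih.1.comp (measurable_seqUpdate _ _)), ?_⟩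
    rw [lintegral_update_add ih.1 p, ih.2, List.length_cons, pow_succ]
    ring

open Classical in
-- Turns counting in fibers into measure: a bound on the count in every fiber bounds the measure of
-- `U`.
theorem two_pow_mul_measure_eq {U : Set BitSeq} (hU : MeasurableSet U) {P : List ℕ}
    (hP : P.Nodup) :
    2 ^ P.length * uniformMeasure U =
      ∫⁻ σ, (((seqFiber P σ).toFinset.filter (· ∈ U)).card : ℝ≥0∞) ∂uniformMeasure := by
  have h1 := (lintegral_sum_seqFiber (measurable_one.indicator hU) P).2
  rw [lintegral_indicator_one hU] at h1
  rw [← h1]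
  refine lintegral_congr fun σ => ?_
  rw [← List.sum_toFinset _ (nodup_seqFiber hP σ)]
  simp [Set.indicator_apply]

end Measure

/-! ### Truncation of sequences to strings -/

section Truncation

/-- The prefix of `σ` of length `M`. -/
def truncSeq (M : ℕ) (σ : BitSeq) : List Bool := (List.range M).map σ

/-- The string `s` is a prefix of `v`. -/
def strPrefix (s v : List Bool) : Bool := decide (v.take s.length = s)

/-- Overwriting a bit of a string. -/
def strUpdate (v : List Bool) (p : ℕ) (b : Bool) : List Bool := v.set p b

@[simp] theorem length_truncSeq (M : ℕ) (σ : BitSeq) : (truncSeq M σ).length = M := by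
  simp [truncSeq]

theorem getElem?_truncSeq (M : ℕ) (σ : BitSeq) (i : ℕ) :
    (truncSeq M σ)[i]? = if i < M then some (σ i) else none := by
  by_cases h : i < M <;> simp [truncSeq, h]

theorem mem_basicSet_iff {s : List Bool} {σ : BitSeq} :
    σ ∈ basicSet s ↔ truncSeq s.length σ = s := by
  constructor
  · intro h
    refine List.ext_getElem? fun i => ?_
    rw [getElem?_truncSeq]
    split_ifs with hi
    · rw [List.getElem?_eq_getElem hi, h i _ (List.getElem?_eq_getElem hi)]
    · rw [List.getElem?_eq_none (not_lt.1 hi)]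
  · intro h i b hb
    have hi : i < s.length := (List.getElem?_eq_some_iff.1 hb).1
    rw [← h, getElem?_truncSeq, if_pos hi] at hb
    simpa using hb

theorem take_truncSeq {M N : ℕ} (h : N ≤ M) (σ : BitSeq) :
    (truncSeq M σ).take N = truncSeq N σ := by
  rw [truncSeq, ← List.map_take, List.take_range, min_eq_left h, truncSeq]

theorem mem_basicSet_truncSeq (M : ℕ) (σ : BitSeq) : σ ∈ basicSet (truncSeq M σ) :=
  mem_basicSet_iff.2 (by rw [length_truncSeq])

theorem strPrefix_truncSeq {s : List Bool} {M : ℕ} (h : s.length ≤ M) (σ : BitSeq) :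
    strPrefix s (truncSeq M σ) = seqPrefix s σ := by
  rw [strPrefix, seqPrefix, take_truncSeq h]
  exact decide_eq_decide.2 mem_basicSet_iff.symm

/-- This holds even for `p ≥ M`, since setting an entry beyond the end leaves a list unchanged. -/
theorem truncSeq_seqUpdate (M : ℕ) (σ : BitSeq) (p : ℕ) (b : Bool) :
    truncSeq M (seqUpdate σ p b) = strUpdate (truncSeq M σ) p b := by
  refine List.ext_getElem? fun i => ?_
  rw [strUpdate, List.getElem?_set, getElem?_truncSeq, getElem?_truncSeq, length_truncSeq]
  by_cases hp : p = i
  · subst hp; simp [seqUpdate]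
  · simp [seqUpdate, hp, Function.update_of_ne (Ne.symm hp)]

theorem isOpen_basicSet (s : List Bool) : IsOpen (basicSet s) := by
  have : basicSet s = ⋂ i ∈ Finset.range s.length, {σ : BitSeq | ∀ b, s[i]? = some b → σ i = b} := by
    ext σ
    simp only [basicSet, Set.mem_ofPred_eq, Set.mem_iInter, Finset.mem_range]
    exact ⟨fun h i _ => h i, fun h i b hb => h i (List.getElem?_eq_some_iff.1 hb).1 b hb⟩
  rw [this]
  refine isOpen_biInter_finset fun i _ => ?_
  change IsOpen ((fun σ : BitSeq => σ i) ⁻¹' {c : Bool | ∀ b, s[i]? = some b → c = b})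
  exact (isOpen_discrete _).preimage (continuous_apply i)

theorem exists_basicSet_subset {V : Set BitSeq} (hV : IsOpen V) {σ : BitSeq} (hσ : σ ∈ V) :
    ∃ M₀, ∀ M ≥ M₀, basicSet (truncSeq M σ) ⊆ V := by
  obtain ⟨I, u, hu, hsub⟩ := isOpen_pi_iff.1 hV σ hσ
  refine ⟨I.sup id + 1, fun M hM τ hτ => hsub fun i hi => ?_⟩
  have hiM : i < M := lt_of_lt_of_le (Nat.lt_succ_of_le (Finset.le_sup (f := id) hi)) hM
  have : τ i = σ i := hτ i (σ i) (by rw [getElem?_truncSeq, if_pos hiM])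
  rw [this]
  exact (hu i hi).2

theorem isOpen_listSet (C : List (List Bool)) : IsOpen (listSet C) := by
  have : listSet C = ⋃ s ∈ C, basicSet s := by ext; simp [listSet]
  rw [this]
  exact isOpen_biUnion fun s _ => isOpen_basicSet s

end Truncation

/-! ### Survivors -/

section Survivor

/-- The set of those sequences that at some time are the survivor of their fiber. -/
def survivorSet (P : List ℕ) (m : ℕ) (D : ℕ → List KillEvent) (s : List Bool) : Set BitSeq :=
  {σ | ∃ t, survivor seqUpdate seqPrefix P m (D t) s σ = some σ}

/-- The string `v` is the survivor of its fiber, and it is long enough to decide this for all the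
sequences that extend it. -/
def survivorTest (P : List ℕ) (m : ℕ) (D : List KillEvent) (s v : List Bool) : Prop :=
  survivor strUpdate strPrefix P m D s v = some v ∧ (∀ p ∈ P, p < v.length) ∧
    (∀ e ∈ D, ∀ c ∈ e.1, c.length ≤ v.length) ∧ s.length ≤ v.length

theorem survivor_eq_some {α : Type*} {upd : α → ℕ → Bool → α} {pre : List Bool → α → Bool}
    {P : List ℕ} {m : ℕ} {D : List KillEvent} {s : List Bool} {a b : α}
    (h : survivor upd pre P m D s a = some b) :
    b ∈ fiberList upd P a ∧ pre s b = true ∧ killed upd pre P m D b = false := by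
  have h1 := List.find?_some h
  simp only [Bool.and_eq_true, Bool.not_eq_true'] at h1
  exact ⟨List.mem_of_find?_eq_some h, h1⟩

variable {P : List ℕ} {m : ℕ} {D : List KillEvent} {s v : List Bool}

theorem survivor_truncSeq {M : ℕ} (hD : ∀ e ∈ D, ∀ c ∈ e.1, c.length ≤ M) (hs : s.length ≤ M)
    (σ : BitSeq) : survivor strUpdate strPrefix P m D s (truncSeq M σ) =
      (survivor seqUpdate seqPrefix P m D s σ).map (truncSeq M) :=
  survivor_map (fun a p b => truncSeq_seqUpdate M a p b) P m
    (fun e he c hc a => strPrefix_truncSeq (hD e he c hc) a) (strPrefix_truncSeq hs) σ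

theorem survivorTest.survivor_eq (h : survivorTest P m D s v) {σ : BitSeq}
    (hσ : σ ∈ basicSet v) : survivor seqUpdate seqPrefix P m D s σ = some σ := by
  obtain ⟨h1, h2, h3, h4⟩ := h
  rw [← mem_basicSet_iff.1 hσ, survivor_truncSeq h3 h4, Option.map_eq_some_iff] at h1
  obtain ⟨τ, hτ, hτσ⟩ := h1
  have hf := mem_seqFiber.1 (survivor_eq_some hτ).1
  rw [hτ]
  congr 1
  funext q
  -- On `P` the two sequences agree because the tested string reaches beyond these positions; off
  -- `P` they agree because they share a fiber.
  by_cases hq : q ∈ P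
  · have := congrArg (·[q]?) hτσ
    simp only [getElem?_truncSeq, if_pos (h2 q hq)] at this
    exact Option.some.inj this
  · exact hf q hq

theorem exists_survivorTest {σ : BitSeq}
    (h : survivor seqUpdate seqPrefix P m D s σ = some σ) :
    ∃ M₀, ∀ M ≥ M₀, survivorTest P m D s (truncSeq M σ) := by
  -- The sums are crude bounds for every position in `P` and every string length in `D`.
  refine ⟨P.sum + 1 + (D.map fun e => (e.1.map List.length).sum).sum + s.length,
    fun M hM => ?_⟩
  have hD : ∀ e ∈ D, ∀ c ∈ e.1, c.length ≤ M := by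
    intro e he c hc
    have h1 : c.length ≤ (e.1.map List.length).sum :=
      List.single_le_sum (by simp) _ (List.mem_map_of_mem hc)
    have h2 : (e.1.map List.length).sum ≤ (D.map fun e => (e.1.map List.length).sum).sum :=
      List.single_le_sum (by simp) _ (List.mem_map_of_mem (f := fun e => (e.1.map List.length).sum) he)
    omega
  have hs : s.length ≤ M := by omega
  refine ⟨by rw [survivor_truncSeq hD hs, h]; rfl, fun p hp => ?_, by simpa using hD, by simpa⟩
  have : p ≤ P.sum := List.single_le_sum (by simp) _ hp
  rw [length_truncSeq]
  omega

theorem isOpen_survivorSet (P : List ℕ) (m : ℕ) (D : ℕ → List KillEvent) (s : List Bool) :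
    IsOpen (survivorSet P m D s) := by
  have : survivorSet P m D s =
      ⋃ (t : ℕ) (v : List Bool) (_ : survivorTest P m (D t) s v), basicSet v := by
    ext σ
    simp only [Set.mem_iUnion, survivorSet, Set.mem_ofPred_eq]
    constructor
    · rintro ⟨t, ht⟩
      obtain ⟨M, hM⟩ := exists_survivorTest ht
      exact ⟨t, _, hM M le_rfl, mem_basicSet_truncSeq M σ⟩
    · rintro ⟨t, v, hv, hσ⟩
      exact ⟨t, hv.survivor_eq hσ⟩
  rw [this]
  exact isOpen_iUnion fun _ => isOpen_iUnion fun v => isOpen_iUnion fun _ => isOpen_basicSet v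

end Survivor

/-! ### Counting survivors -/

section Counting

/-- A set `A` of maximal size absorbs every set of the family that meets it. The rest is disjoint
from `A` and is treated by induction. -/
theorem dvd_card_biUnion_of_laminar {α : Type*} [DecidableEq α] {m : ℕ} (F : Finset (Finset α))
    (hl : ∀ A ∈ F, ∀ B ∈ F, A ⊆ B ∨ B ⊆ A ∨ Disjoint A B) (hm : ∀ A ∈ F, m ∣ A.card) :
    m ∣ (F.biUnion id).card := by
  induction h : F.card using Nat.strong_induction_on generalizing F with
  | _ n ih =>
    rcases F.eq_empty_or_nonempty with rfl | hne
    · simp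
    obtain ⟨A, hA, hmax⟩ := F.exists_max_image Finset.card hne
    let G := (F.erase A).filter fun B => Disjoint A B
    have hG : G ⊆ F.erase A := Finset.filter_subset _ _
    have hcard : G.card < n := by
      have := Finset.card_le_card hG
      have := Finset.card_erase_lt_of_mem hA
      omega
    have hGF : ∀ B ∈ G, B ∈ F := fun B hB => Finset.mem_of_mem_erase (hG hB)
    have ihG := ih _ hcard G (fun B hB C hC => hl B (hGF B hB) C (hGF C hC))
      (fun B hB => hm B (hGF B hB)) rfl
    have hunion : F.biUnion id = A ∪ G.biUnion id := by
      ext a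
      simp only [Finset.mem_biUnion, id, Finset.mem_union]
      constructor
      · rintro ⟨B, hB, ha⟩
        by_cases haA : a ∈ A
        · exact Or.inl haA
        refine Or.inr ⟨B, ?_, ha⟩
        have hBA : B ≠ A := by rintro rfl; exact haA ha
        refine Finset.mem_filter.2 ⟨Finset.mem_erase.2 ⟨hBA, hB⟩, ?_⟩
        rcases hl A hA B hB with h1 | h1 | h1
        · exact absurd (Finset.eq_of_subset_of_card_le h1 (hmax B hB)).symm hBA
        · exact absurd (h1 ha) haA
        · exact h1
      · rintro (ha | ⟨B, hB, ha⟩)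
        · exact ⟨A, hA, ha⟩
        · exact ⟨B, hGF B hB, ha⟩
    have hdisj : Disjoint A (G.biUnion id) :=
      (Finset.disjoint_biUnion_right _ _ _).2 fun B hB => (Finset.mem_filter.1 hB).2
    rw [hunion, Finset.card_union_of_disjoint hdisj]
    exact dvd_add (hm A hA) ihG

/-- The potential is the sum of the sizes of `KA t` and `KB t` divided by `m`. It never exceeds `2 *
l.length / m`, and it increases strictly whenever the first admissible element changes, because the
old one must have been killed. -/
theorem card_find?_mul_le {α : Type*} [DecidableEq α] (l : List α) (hl : l.Nodup) (p : α → Bool)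
    (K : ℕ → α → Bool) (KA KB : ℕ → Finset α) (hA : Monotone KA) (hB : Monotone KB)
    (hAl : ∀ t, KA t ⊆ l.toFinset) (hBl : ∀ t, KB t ⊆ l.toFinset)
    (hK : ∀ t, ∀ a ∈ l, K t a = true ↔ a ∈ KA t ∨ a ∈ KB t) {m : ℕ}
    (hmA : ∀ t, m ∣ (KA t).card) (hmB : ∀ t, m ∣ (KB t).card) (U : Finset α)
    (hU : ∀ u ∈ U, ∃ t, l.find? (fun b => p b && !K t b) = some u) :
    U.card * m ≤ 2 * l.length + m := by
  rcases Nat.eq_zero_or_pos m with rfl | hm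
  · simp
  choose a ha using hmA
  choose b hb using hmB
  choose! T hT using hU
  have hstrict : ∀ t t' u u', t ≤ t' → l.find? (fun b => p b && !K t b) = some u →
      l.find? (fun b => p b && !K t' b) = some u' → u ≠ u' → a t + b t < a t' + b t' := by
    intro t t' u u' htt h h' hne
    have hul := List.mem_of_find?_eq_some h
    obtain ⟨hu, as, bs, rfl, has⟩ := List.find?_eq_some_iff_append.1 h
    simp only [Bool.and_eq_true, Bool.not_eq_true'] at hu
    have hKm : ∀ x ∈ as ++ u :: bs, K t x = true → K t' x = true := by
      intro x hx hKx
      rw [hK t' x hx]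
      exact ((hK t x hx).1 hKx).imp (fun h => hA htt h) (fun h => hB htt h)
    -- If `u` were still alive at `t'`, it would still come first, since all elements before it stay
    -- rejected.
    have hut' : K t' u = true := by
      by_contra hcon
      refine hne ?_
      have : (as ++ u :: bs).find? (fun b => p b && !K t' b) = some u := by
        refine List.find?_eq_some_iff_append.2 ⟨by simpa [hu.1] using hcon, as, bs, rfl, ?_⟩
        intro x hx
        have h1 := has x hx
        have h2 := hKm x (by simp [hx])
        cases hp : p x <;> cases hk : K t x <;> simp_all
      rw [this] at h'
      exact Option.some.inj h'
    have hut : ¬ (u ∈ KA t ∨ u ∈ KB t) := by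
      rw [← hK t u hul, hu.2]; simp
    have key : m * (a t + b t) < m * (a t' + b t') := by
      rw [mul_add, mul_add, ← ha, ← hb, ← ha, ← hb]
      rcases (hK t' u hul).1 hut' with h1 | h1
      · have := Finset.card_lt_card (Finset.ssubset_iff_of_subset (hA htt) |>.2
          ⟨u, h1, fun h => hut (Or.inl h)⟩)
        have := Finset.card_le_card (hB htt)
        omega
      · have := Finset.card_lt_card (Finset.ssubset_iff_of_subset (hB htt) |>.2
          ⟨u, h1, fun h => hut (Or.inr h)⟩)
        have := Finset.card_le_card (hA htt)
        omega
    exact lt_of_mul_lt_mul_left key (Nat.zero_le m)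
  have hinj : Set.InjOn (fun u => a (T u) + b (T u)) U := by
    intro u hu u' hu' huu
    by_contra hne
    simp only at huu
    rcases le_total (T u) (T u') with h | h
    · exact absurd huu (hstrict _ _ _ _ h (hT u hu) (hT u' hu') hne).ne
    · exact absurd huu (hstrict _ _ _ _ h (hT u' hu') (hT u hu) (Ne.symm hne)).ne'
  have hbound : ∀ t, a t + b t ≤ 2 * l.length / m := by
    intro t
    rw [Nat.le_div_iff_mul_le hm, mul_comm, mul_add, ← ha, ← hb]
    have h1 := Finset.card_le_card (hAl t)
    have h2 := Finset.card_le_card (hBl t)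
    rw [List.toFinset_card_of_nodup hl] at h1 h2
    omega
  have hcard : U.card ≤ 2 * l.length / m + 1 := by
    rw [← Finset.card_range (2 * l.length / m + 1)]
    exact Finset.card_le_card_of_injOn _
      (fun u _ => Finset.mem_coe.2 (Finset.mem_range.2 (Nat.lt_succ_of_le (hbound _)))) hinj
  calc U.card * m ≤ (2 * l.length / m + 1) * m := Nat.mul_le_mul_right m hcard
    _ = 2 * l.length / m * m + m := by ring
    _ ≤ 2 * l.length + m := Nat.add_le_add_right (Nat.div_mul_le_self _ _) m

/-- A laminar family of sets that meet every fiber of `P` either in no elements or in a number of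
elements that is a power of two. -/
structure IsDyadicLaminar (P : List ℕ) (𝒜 : Set (Set BitSeq)) : Prop where
  laminar : ∀ A ∈ 𝒜, ∀ B ∈ 𝒜, A ⊆ B ∨ B ⊆ A ∨ Disjoint A B
  dyadic : ∀ C, listSet C ∈ 𝒜 → ∀ σ, fiberCount seqUpdate seqPrefix P C σ = 0 ∨
    ∃ k, fiberCount seqUpdate seqPrefix P C σ = 2 ^ k

theorem hits_seq_iff {P : List ℕ} {m : ℕ} {e : KillEvent} {σ : BitSeq} :
    hits seqUpdate seqPrefix P m e σ = true ↔ σ ∈ listSet e.1 ∧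
      fiberCount seqUpdate seqPrefix e.2.1 e.1 σ < e.2.2 ∧
      m ≤ fiberCount seqUpdate seqPrefix P e.1 σ := by
  simp [hits, coverTest_seqPrefix]

open Classical in
-- Both counts in an event are constant on the fiber of `P`, because `P` is contained in the block
-- of the event. So an event kills either nothing in the fiber or its whole trace there, whose size
-- is then a power of two that is at least `2 ^ k`. These traces are laminar.
theorem dvd_card_filter_hits {P : List ℕ} (hP : P.Nodup) {𝒜 : Set (Set BitSeq)}
    (h𝒜 : IsDyadicLaminar P 𝒜) {k : ℕ} (D : List KillEvent)
    (hD : ∀ e ∈ D, P ⊆ e.2.1) (σ : BitSeq) :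
    2 ^ k ∣ ((seqFiber P σ).toFinset.filter fun τ => ∃ e ∈ D, listSet e.1 ∈ 𝒜 ∧
      hits seqUpdate seqPrefix P (2 ^ k) e τ = true).card := by
  let G : KillEvent → Finset BitSeq := fun e => (seqFiber P σ).toFinset.filter fun τ =>
    hits seqUpdate seqPrefix P (2 ^ k) e τ = true
  have hG : ∀ e ∈ D, G e = ∅ ∨ (2 ^ k ≤ fiberCount seqUpdate seqPrefix P e.1 σ ∧
      G e = (seqFiber P σ).toFinset.filter (· ∈ listSet e.1)) := by
    intro e he
    by_cases hc : fiberCount seqUpdate seqPrefix e.2.1 e.1 σ < e.2.2 ∧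
      2 ^ k ≤ fiberCount seqUpdate seqPrefix P e.1 σ
    · refine Or.inr ⟨hc.2, Finset.filter_congr fun τ hτ => ?_⟩
      have hτ := List.mem_toFinset.1 hτ
      rw [hits_seq_iff, fiberCount_congr hτ, fiberCount_congr (seqFiber_mono (hD e he) hτ)]
      exact ⟨fun h => h.1, fun h => ⟨h, hc⟩⟩
    · refine Or.inl (Finset.filter_eq_empty_iff.2 fun τ hτ h => hc ?_)
      have hτ := List.mem_toFinset.1 hτ
      rw [hits_seq_iff, fiberCount_congr hτ, fiberCount_congr (seqFiber_mono (hD e he) hτ)] at h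
      exact h.2
  have heq : ((seqFiber P σ).toFinset.filter fun τ => ∃ e ∈ D, listSet e.1 ∈ 𝒜 ∧
      hits seqUpdate seqPrefix P (2 ^ k) e τ = true) =
      ((D.toFinset.filter fun e => listSet e.1 ∈ 𝒜).image G).biUnion id := by
    ext τ
    simp only [Finset.mem_filter, Finset.mem_biUnion, Finset.mem_image, List.mem_toFinset, G, id]
    constructor
    · rintro ⟨h1, e, he, h2, h3⟩
      exact ⟨_, ⟨e, ⟨he, h2⟩, rfl⟩, by simpa using ⟨h1, h3⟩⟩
    · rintro ⟨_, ⟨e, ⟨he, h2⟩, rfl⟩, h3⟩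
      simp only [Finset.mem_filter, List.mem_toFinset] at h3
      exact ⟨h3.1, e, he, h2, h3.2⟩
  rw [heq]
  refine dvd_card_biUnion_of_laminar _ ?_ ?_
  · intro A hA B hB
    simp only [Finset.mem_image, Finset.mem_filter, List.mem_toFinset] at hA hB
    obtain ⟨e, ⟨he, he'⟩, rfl⟩ := hA
    obtain ⟨f, ⟨hf, hf'⟩, rfl⟩ := hB
    rcases hG e he with h | ⟨-, h⟩
    · rw [h]; exact Or.inl (Finset.empty_subset _)
    rcases hG f hf with h' | ⟨-, h'⟩
    · rw [h']; exact Or.inr (Or.inl (Finset.empty_subset _))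
    rw [h, h']
    rcases h𝒜.laminar _ he' _ hf' with h1 | h1 | h1
    · exact Or.inl (Finset.monotone_filter_right _ fun τ _ hτ => h1 hτ)
    · exact Or.inr (Or.inl (Finset.monotone_filter_right _ fun τ _ hτ => h1 hτ))
    · refine Or.inr (Or.inr (Finset.disjoint_left.2 fun τ h2 h3 => ?_))
      exact Set.disjoint_left.1 h1 (Finset.mem_filter.1 h2).2 (Finset.mem_filter.1 h3).2
  · intro A hA
    simp only [Finset.mem_image, Finset.mem_filter, List.mem_toFinset] at hA
    obtain ⟨e, ⟨he, he'⟩, rfl⟩ := hA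
    rcases hG e he with h | ⟨hk, h⟩
    · rw [h]; simp
    rw [h, ← fiberCount_eq_card hP]
    rcases h𝒜.dyadic _ he' σ with h1 | ⟨j, h1⟩
    · rw [h1]; simp
    · rw [h1] at hk ⊢
      exact pow_dvd_pow 2 ((Nat.pow_le_pow_iff_right (by norm_num)).1 hk)

theorem killed_mono {P : List ℕ} {m : ℕ} {D D' : List KillEvent} (h : D ⊆ D') {σ : BitSeq}
    (hk : killed seqUpdate seqPrefix P m D σ = true) :
    killed seqUpdate seqPrefix P m D' σ = true := by
  simp only [killed, List.any_eq_true] at hk ⊢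
  obtain ⟨e, he, h1⟩ := hk
  exact ⟨e, h he, h1⟩

open Classical in
theorem card_survivorSet_mul_le {P : List ℕ} (hP : P.Nodup) {𝒜 ℬ : Set (Set BitSeq)}
    (h𝒜 : IsDyadicLaminar P 𝒜) (hℬ : IsDyadicLaminar P ℬ) {k : ℕ} {D : ℕ → List KillEvent}
    (hmono : ∀ t t', t ≤ t' → D t ⊆ D t') (hD : ∀ t, ∀ e ∈ D t, P ⊆ e.2.1)
    (hmem : ∀ t, ∀ e ∈ D t, listSet e.1 ∈ 𝒜 ∨ listSet e.1 ∈ ℬ) (s : List Bool) (σ : BitSeq) :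
    ((seqFiber P σ).toFinset.filter (· ∈ survivorSet P (2 ^ k) D s)).card * 2 ^ k ≤
      2 * 2 ^ P.length + 2 ^ k := by
  have hlen : (seqFiber P σ).length = 2 ^ P.length := length_fiberList _ _ _
  rw [← hlen]
  let KK : Set (Set BitSeq) → ℕ → Finset BitSeq := fun 𝒜 t =>
    (seqFiber P σ).toFinset.filter fun τ => ∃ e ∈ D t, listSet e.1 ∈ 𝒜 ∧
      hits seqUpdate seqPrefix P (2 ^ k) e τ = true
  have hKK : ∀ 𝒜, Monotone (KK 𝒜) := fun 𝒜 t t' h =>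
    Finset.monotone_filter_right _ fun τ _ ⟨e, he, h1⟩ => ⟨e, hmono t t' h he, h1⟩
  refine card_find?_mul_le (seqFiber P σ) (nodup_seqFiber hP σ) (seqPrefix s)
    (fun t => killed seqUpdate seqPrefix P (2 ^ k) (D t)) (KK 𝒜) (KK ℬ) (hKK 𝒜) (hKK ℬ)
    (fun t => Finset.filter_subset _ _) (fun t => Finset.filter_subset _ _) ?_
    (fun t => dvd_card_filter_hits hP h𝒜 (D t) (hD t) σ)
    (fun t => dvd_card_filter_hits hP hℬ (D t) (hD t) σ) _ ?_
  · intro t τ hτ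
    simp only [KK, Finset.mem_filter, List.mem_toFinset, hτ, true_and, killed, List.any_eq_true]
    constructor
    · rintro ⟨e, he, h1⟩
      exact (hmem t e he).imp (fun h => ⟨e, he, h, h1⟩) (fun h => ⟨e, he, h, h1⟩)
    · rintro (⟨e, he, -, h1⟩ | ⟨e, he, -, h1⟩) <;> exact ⟨e, he, h1⟩
  · intro u hu
    obtain ⟨hu, t, ht⟩ := Finset.mem_filter.1 hu
    rw [survivor_congr (List.mem_toFinset.1 hu)] at ht
    exact ⟨t, ht⟩

/-- Averages the bound for single fibers; `k ≤ P.length` absorbs the summand `2 ^ k` into the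
constant 3. -/
theorem measure_survivorSet_le {P : List ℕ} (hP : P.Nodup) {𝒜 ℬ : Set (Set BitSeq)}
    (h𝒜 : IsDyadicLaminar P 𝒜) (hℬ : IsDyadicLaminar P ℬ) {k : ℕ} (hk : k ≤ P.length)
    {D : ℕ → List KillEvent}
    (hmono : ∀ t t', t ≤ t' → D t ⊆ D t') (hD : ∀ t, ∀ e ∈ D t, P ⊆ e.2.1)
    (hmem : ∀ t, ∀ e ∈ D t, listSet e.1 ∈ 𝒜 ∨ listSet e.1 ∈ ℬ) (s : List Bool) :
    uniformMeasure (survivorSet P (2 ^ k) D s) * 2 ^ k ≤ 3 := by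
  classical
  have h1 := two_pow_mul_measure_eq (isOpen_survivorSet P (2 ^ k) D s).measurableSet hP
  have h2 : 2 ^ P.length * (uniformMeasure (survivorSet P (2 ^ k) D s) * 2 ^ k) ≤
      2 ^ P.length * 3 := by
    rw [← mul_assoc, h1, ← lintegral_mul_const' _ _ (by finiteness)]
    calc ∫⁻ σ, (((seqFiber P σ).toFinset.filter
          (· ∈ survivorSet P (2 ^ k) D s)).card : ℝ≥0∞) * 2 ^ k ∂uniformMeasure
        ≤ ∫⁻ _, 2 ^ P.length * 3 ∂uniformMeasure := by
          refine lintegral_mono fun σ => ?_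
          have h3 := card_survivorSet_mul_le hP h𝒜 hℬ hmono hD hmem s σ (k := k)
          have h4 : 2 ^ k ≤ 2 ^ P.length := Nat.pow_le_pow_right (by norm_num) hk
          have h5 := h3.trans (show _ ≤ 2 ^ P.length * 3 by omega)
          have h6 := (Nat.cast_le (α := ℝ≥0∞)).2 h5
          push_cast at h6
          exact h6
      _ = 2 ^ P.length * 3 := by simp
  exact (ENNReal.mul_le_mul_iff_right (by simp) (by finiteness)).1 h2

/-- The fiber is finite, so from some time on no further element of it is killed. The survivor at
that time is never killed. -/
theorem exists_mem_survivorSet {P : List ℕ} {m : ℕ} {D : ℕ → List KillEvent}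
    (hmono : ∀ t t', t ≤ t' → D t ⊆ D t') {s : List Bool} {σ : BitSeq} (hs : σ ∈ basicSet s)
    (hσ : ∀ t, killed seqUpdate seqPrefix P m (D t) σ = false) :
    ∃ τ ∈ survivorSet P m D s, τ ∈ basicSet s ∧
      ∀ t, killed seqUpdate seqPrefix P m (D t) τ = false := by
  have hT : ∃ T, ∀ τ ∈ seqFiber P σ, (∃ t, killed seqUpdate seqPrefix P m (D t) τ = true) →
      killed seqUpdate seqPrefix P m (D T) τ = true := by
    have hev : ∀ᶠ T in atTop, ∀ τ ∈ {τ | τ ∈ seqFiber P σ},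
        (∃ t, killed seqUpdate seqPrefix P m (D t) τ = true) →
        killed seqUpdate seqPrefix P m (D T) τ = true := by
      rw [eventually_all_finite (List.finite_toSet _)]
      intro τ _
      by_cases h : ∃ t, killed seqUpdate seqPrefix P m (D t) τ = true
      · obtain ⟨t, ht⟩ := h
        filter_upwards [eventually_ge_atTop t] with T hT _
        exact killed_mono (hmono t T hT) ht
      · exact Eventually.of_forall fun T h' => absurd h' h
    exact hev.exists
  obtain ⟨T, hT⟩ := hT
  have hsome : (survivor seqUpdate seqPrefix P m (D T) s σ).isSome := by
    rw [survivor, List.find?_isSome]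
    exact ⟨σ, self_mem_seqFiber P σ, by simp [hs, hσ T]⟩
  obtain ⟨τ, hτ⟩ := Option.isSome_iff_exists.1 hsome
  obtain ⟨h1, h2, h3⟩ := survivor_eq_some hτ
  refine ⟨τ, ⟨T, by rw [survivor_congr h1, hτ]⟩, seqPrefix_eq_true.1 h2, fun t => ?_⟩
  by_contra hcon
  rw [hT τ h1 ⟨t, by simpa using hcon⟩] at h3
  exact absurd h3 (by simp)

end Counting

/-! ### Laminarity of the parts of a refinement -/

namespace PartitionRefinement

variable {Ω : Type*} (S : PartitionRefinement Ω)

theorem eventualPart_nil : S.eventualPart [] = Set.univ := S.eventualPart_eq S.root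

theorem exists_of_mem_eventualPart {x : List Bool} {ω : Ω} (h : ω ∈ S.eventualPart x) :
    ∃ t, S.eventualPart x ∈ S.part t x := by
  obtain ⟨t, v, hv, -⟩ := h
  exact ⟨t, by rwa [S.eventualPart_eq hv]⟩

theorem eventualPart_append_subset (x y : List Bool) :
    S.eventualPart (x ++ y) ⊆ S.eventualPart x := by
  induction y using List.reverseRecOn with
  | nil => simp
  | append_singleton y b ih =>
    refine subset_trans ?_ ih
    rw [← List.append_assoc]
    rintro ω ⟨t, v, hv, hω⟩
    obtain ⟨u, hu, w, -, h, -⟩ := S.exists_parent hv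
    exact ⟨t, u, hu, h ▸ Or.inl hω⟩

theorem disjoint_eventualPart_concat (x : List Bool) (b : Bool) :
    Disjoint (S.eventualPart (x ++ [b])) (S.eventualPart (x ++ [!b])) := by
  rw [Set.disjoint_left]
  rintro ω ⟨t, v, hv, hω⟩ ⟨t', v', hv', hω'⟩
  obtain ⟨u, hu, w, hw, -, h⟩ := S.exists_parent hv
  rw [S.part_unique hv' hw] at hω'
  exact Set.disjoint_left.1 h hω hω'

/-- At the first bit where the coordinates differ, the parts would lie in disjoint siblings. -/
theorem prefix_of_mem_eventualPart {x y : List Bool} {ω : Ω} (hx : ω ∈ S.eventualPart x)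
    (hy : ω ∈ S.eventualPart y) (h : x.length ≤ y.length) : x <+: y := by
  induction x using List.reverseRecOn with
  | nil => exact List.nil_prefix
  | append_singleton x b ih =>
    obtain ⟨z, rfl⟩ := ih (S.eventualPart_append_subset x [b] hx) (by simp at h; omega)
    cases z with
    | nil => simp at h
    | cons c z =>
      rw [List.append_cons] at hy
      have hc := S.eventualPart_append_subset (x ++ [c]) z hy
      have : c = b := by
        by_contra hne
        have hcb : c = !b := by cases b <;> cases c <;> simp_all
        rw [hcb] at hc
        exact Set.disjoint_left.1 (S.disjoint_eventualPart_concat x b) hx hc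
      exact ⟨z, by simp [this]⟩

theorem eventualPart_laminar (x y : List Bool) :
    S.eventualPart x ⊆ S.eventualPart y ∨ S.eventualPart y ⊆ S.eventualPart x ∨
      Disjoint (S.eventualPart x) (S.eventualPart y) := by
  by_cases hd : Disjoint (S.eventualPart x) (S.eventualPart y)
  · exact Or.inr (Or.inr hd)
  obtain ⟨ω, hx, hy⟩ := Set.not_disjoint_iff.1 hd
  rcases le_total x.length y.length with h | h
  · obtain ⟨z, rfl⟩ := S.prefix_of_mem_eventualPart hx hy h
    exact Or.inr (Or.inl (S.eventualPart_append_subset _ _))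
  · obtain ⟨z, rfl⟩ := S.prefix_of_mem_eventualPart hy hx h
    exact Or.inl (S.eventualPart_append_subset _ _)

/-- The split happens at the least time at which a child is defined. -/
theorem exists_splitsInto {t : ℕ} {x : List Bool} {b : Bool} {v : Set Ω}
    (hv : v ∈ S.part t (x ++ [b])) :
    ∃ t' ≤ t, S.SplitsInto t' x (S.eventualPart (x ++ [false])) (S.eventualPart (x ++ [true])) := by
  classical
  have hex : ∃ t, (S.part t (x ++ [false])).Dom := by
    cases b
    · exact ⟨t, Part.dom_iff_mem.2 ⟨v, hv⟩⟩
    · exact ⟨t, (S.split_dom t x true (Part.dom_iff_mem.2 ⟨v, hv⟩)).2.2⟩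
  have hdom := Nat.find_spec hex
  have hle : Nat.find hex ≤ t := Nat.find_min' hex (by
    cases b
    · exact Part.dom_iff_mem.2 ⟨v, hv⟩
    · exact (S.split_dom t x true (Part.dom_iff_mem.2 ⟨v, hv⟩)).2.2)
  obtain ⟨h0, h1, h2⟩ := S.split_dom _ x false hdom
  obtain ⟨v₀, hv₀⟩ := Part.dom_iff_mem.1 hdom
  obtain ⟨v₁, hv₁⟩ := Part.dom_iff_mem.1 h2
  rw [Bool.not_false] at hv₁
  refine ⟨_, hle, h0, ⟨h1, fun c hc => ?_⟩, by rwa [S.eventualPart_eq hv₀],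
    by rwa [S.eventualPart_eq hv₁]⟩
  refine Nat.find_min hex (Nat.sub_lt h0 one_pos) ?_
  cases c
  · exact hc
  · exact (S.split_dom _ x true hc).2.2

theorem eventualPart_concat_union {t : ℕ} {x : List Bool} {b : Bool} {v : Set Ω}
    (hv : v ∈ S.part t (x ++ [b])) :
    S.eventualPart (x ++ [b]) ∪ S.eventualPart (x ++ [!b]) = S.eventualPart x := by
  obtain ⟨u, hu, w, hw, h, -⟩ := S.exists_parent hv
  rw [S.eventualPart_eq hv, S.eventualPart_eq hw, S.eventualPart_eq hu, h]

end PartitionRefinement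

/-! ### Fibers of blocks of positions -/

section Block

/-- The first `ℓ` members of a sequence of positions. -/
def block (π : ℕ → ℕ) (ℓ : ℕ) : List ℕ := (List.range ℓ).map π

@[simp] theorem length_block (π : ℕ → ℕ) (ℓ : ℕ) : (block π ℓ).length = ℓ := by simp [block]

theorem nodup_block {π : ℕ → ℕ} (hπ : Function.Injective π) (ℓ : ℕ) : (block π ℓ).Nodup :=
  List.nodup_range.map hπ

theorem block_subset {π : ℕ → ℕ} {ℓ ℓ' : ℕ} (h : ℓ ≤ ℓ') : block π ℓ ⊆ block π ℓ' := by
  intro p hp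
  simp only [block, List.mem_map, List.mem_range] at hp ⊢
  obtain ⟨i, hi, rfl⟩ := hp
  exact ⟨i, by omega, rfl⟩

theorem unrestricted_tailRestriction_finite (π : ℕ → ℕ) (ℓ : ℕ) (σ : BitSeq) :
    (tailRestriction π ℓ σ).unrestricted.Finite := by
  refine ((Finset.range ℓ).image π).finite_toSet.subset fun p hp => ?_
  by_contra h
  have h : p ∉ (Finset.range ℓ).image π := h
  simp [BitRestriction.unrestricted, tailRestriction] at hp
  simp at h
  tauto

theorem mem_consistent_tailRestriction {π : ℕ → ℕ} {ℓ : ℕ} {σ τ : BitSeq} :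
    τ ∈ (tailRestriction π ℓ σ).consistent ↔ τ ∈ seqFiber (block π ℓ) σ := by
  rw [mem_seqFiber]
  have hmem : ∀ p, p ∈ block π ℓ ↔ p ∈ (Finset.range ℓ).image π := by
    intro p; simp [block]
  constructor
  · intro h q hq
    exact h q (σ q) (by rw [tailRestriction, if_neg (by rwa [← hmem])])
  · intro h p b hb
    by_cases hp : p ∈ (Finset.range ℓ).image π
    · simp only [tailRestriction, if_pos hp] at hb
      cases hb
    · rw [h p (by rwa [hmem])]
      simpa only [tailRestriction, if_neg hp, Option.some.injEq] using hb

open Classical in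
/-- The number of elements of `V` in the fiber of `σ`. -/
noncomputable def fiberCard (P : List ℕ) (V : Set BitSeq) (σ : BitSeq) : ℕ :=
  ((seqFiber P σ).toFinset.filter (· ∈ V)).card

theorem fiberCount_eq_fiberCard {P : List ℕ} (hP : P.Nodup) (C : List (List Bool)) (σ : BitSeq) :
    fiberCount seqUpdate seqPrefix P C σ = fiberCard P (listSet C) σ :=
  fiberCount_eq_card hP C σ

theorem ncard_inter_tailRestriction (π : ℕ → ℕ) (ℓ : ℕ) (σ : BitSeq) (V : Set BitSeq) :
    (V ∩ (tailRestriction π ℓ σ).consistent).ncard = fiberCard (block π ℓ) V σ := by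
  classical
  rw [fiberCard, ← Set.ncard_coe_finset]
  congr 1
  ext τ
  simp [mem_consistent_tailRestriction, and_comm]

theorem fiberCard_union {P : List ℕ} {V W : Set BitSeq} (h : Disjoint V W) (σ : BitSeq) :
    fiberCard P (V ∪ W) σ = fiberCard P V σ + fiberCard P W σ := by
  classical
  rw [fiberCard, fiberCard, fiberCard, ← Finset.card_union_of_disjoint]
  · congr 1
    ext τ
    simp only [Finset.mem_filter, Finset.mem_union, Set.mem_union]
    tauto
  · rw [Finset.disjoint_left]
    intro τ h1 h2
    exact Set.disjoint_left.1 h (Finset.mem_filter.1 h1).2 (Finset.mem_filter.1 h2).2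

theorem fiberCard_univ {P : List ℕ} (hP : P.Nodup) (σ : BitSeq) :
    fiberCard P Set.univ σ = 2 ^ P.length := by
  classical
  simp only [fiberCard, Set.mem_univ, Finset.filter_true]
  rw [List.toFinset_card_of_nodup (nodup_seqFiber hP σ)]
  exact length_fiberList _ _ _

theorem fiberCard_pos_iff {P : List ℕ} {V : Set BitSeq} {σ : BitSeq} :
    0 < fiberCard P V σ ↔ ∃ τ ∈ V, τ ∈ seqFiber P σ := by
  classical
  rw [fiberCard, Finset.card_pos]
  constructor
  · rintro ⟨τ, hτ⟩
    exact ⟨τ, (Finset.mem_filter.1 hτ).2, List.mem_toFinset.1 (Finset.mem_filter.1 hτ).1⟩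
  · rintro ⟨τ, h1, h2⟩
    exact ⟨τ, Finset.mem_filter.2 ⟨List.mem_toFinset.2 h2, h1⟩⟩

theorem inter_tailRestriction_nonempty {π : ℕ → ℕ} {ℓ : ℕ} {σ : BitSeq} {V : Set BitSeq} :
    (V ∩ (tailRestriction π ℓ σ).consistent).Nonempty ↔ 0 < fiberCard (block π ℓ) V σ := by
  rw [fiberCard_pos_iff]
  exact exists_congr fun τ => and_congr_right fun _ => mem_consistent_tailRestriction

end Block

namespace BettingStrategy

variable {B : BettingStrategy}

/-! ### Halving -/

section Halving

theorem IsHalfSplitting.fiberCard_eq (hB : B.IsHalfSplitting) {π : ℕ → ℕ} {ℓ : ℕ} {σ : BitSeq}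
    {t : ℕ} {x : List Bool} {b : Bool} {v : Set BitSeq} (hv : v ∈ B.S.part t (x ++ [b]))
    (h₀ : 0 < fiberCard (block π ℓ) (B.S.eventualPart (x ++ [b])) σ)
    (h₁ : 0 < fiberCard (block π ℓ) (B.S.eventualPart (x ++ [!b])) σ) :
    fiberCard (block π ℓ) (B.S.eventualPart (x ++ [b])) σ =
      fiberCard (block π ℓ) (B.S.eventualPart (x ++ [!b])) σ := by
  obtain ⟨t', -, hs⟩ := B.S.exists_splitsInto hv
  have key := hB (tailRestriction π ℓ σ) (unrestricted_tailRestriction_finite π ℓ σ) t' x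
    (B.S.eventualPart (x ++ [false])) (B.S.eventualPart (x ++ [true]))
  simp only [PartitionRefinement.SplitsOnInto, inter_tailRestriction_nonempty,
    ncard_inter_tailRestriction] at key
  cases b
  · exact key ⟨hs, h₀, h₁⟩
  · exact (key ⟨hs, h₁, h₀⟩).symm

theorem fiberCard_concat_add {t : ℕ} {x : List Bool} {b : Bool} {v : Set BitSeq}
    (hv : v ∈ B.S.part t (x ++ [b])) (P : List ℕ) (σ : BitSeq) :
    fiberCard P (B.S.eventualPart x) σ = fiberCard P (B.S.eventualPart (x ++ [b])) σ +
      fiberCard P (B.S.eventualPart (x ++ [!b])) σ := by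
  rw [← B.S.eventualPart_concat_union hv, fiberCard_union (B.S.disjoint_eventualPart_concat x b)]

/-- The product is invariant along coordinates: passing to a child that meets the fiber either
halves the count and adds one split, or changes neither. -/
theorem IsHalfSplitting.fiberCard_mul_numSplitsOn (hB : B.IsHalfSplitting) {π : ℕ → ℕ}
    (hπ : Function.Injective π) {ℓ : ℕ} {σ : BitSeq} {t : ℕ} {x : List Bool} {v : Set BitSeq}
    (hv : v ∈ B.S.part t x) (h : 0 < fiberCard (block π ℓ) (B.S.eventualPart x) σ) :
    fiberCard (block π ℓ) (B.S.eventualPart x) σ *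
      2 ^ B.S.numSplitsOn (tailRestriction π ℓ σ) t x = 2 ^ ℓ := by
  induction x using List.reverseRecOn generalizing v with
  | nil =>
    have : {y : List Bool | y <+: [] ∧ y ≠ [] ∧ ∃ t' ≤ t, ∃ v₀ v₁,
        B.S.SplitsOnInto (tailRestriction π ℓ σ) t' y v₀ v₁} = ∅ := by
      ext y
      simp only [List.prefix_nil, Set.mem_ofPred_eq, Set.mem_empty_iff_false, iff_false]
      tauto
    rw [PartitionRefinement.numSplitsOn, this, B.S.eventualPart_nil, fiberCard_univ
      (nodup_block hπ ℓ), length_block]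
    simp
  | append_singleton x b ih =>
    obtain ⟨u, hu, w, hw, -, -⟩ := B.S.exists_parent hv
    have hadd := fiberCard_concat_add hv (block π ℓ) σ
    have ihx := ih hu (by omega)
    let s : List Bool → Set (List Bool) := fun x => {y : List Bool | y <+: x ∧ y ≠ x ∧
      ∃ t' ≤ t, ∃ v₀ v₁, B.S.SplitsOnInto (tailRestriction π ℓ σ) t' y v₀ v₁}
    have hfin : (s x).Finite :=
      (List.finite_toSet x.inits).subset fun y hy => (List.mem_inits _ _).2 hy.1
    have hns : ∀ x, B.S.numSplitsOn (tailRestriction π ℓ σ) t x = (s x).ncard := fun _ => rfl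
    have hpre : ∀ y : List Bool, (y <+: x ++ [b] ∧ y ≠ x ++ [b]) ↔
        ((y <+: x ∧ y ≠ x) ∨ y = x) := by
      intro y
      rw [List.prefix_concat_iff]
      constructor
      · rintro ⟨h1 | h1, h2⟩
        · exact absurd h1 h2
        · by_cases h3 : y = x <;> tauto
      · rintro (⟨h1, -⟩ | rfl)
        · refine ⟨Or.inr h1, ?_⟩
          rintro rfl
          have := h1.length_le
          simp at this
        · exact ⟨Or.inr (List.prefix_refl _), by simp⟩
    -- The part is split on the restriction exactly if the sibling also meets the fiber.
    by_cases h₁ : 0 < fiberCard (block π ℓ) (B.S.eventualPart (x ++ [!b])) σ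
    · have heq := hB.fiberCard_eq hv h h₁
      obtain ⟨t', ht', hs⟩ := B.S.exists_splitsInto hv
      have hso : B.S.SplitsOnInto (tailRestriction π ℓ σ) t' x
          (B.S.eventualPart (x ++ [false])) (B.S.eventualPart (x ++ [true])) := by
        refine ⟨hs, ?_⟩
        rw [inter_tailRestriction_nonempty, inter_tailRestriction_nonempty]
        cases b
        · exact ⟨h, h₁⟩
        · exact ⟨h₁, h⟩
      have hins : s (x ++ [b]) = insert x (s x) := by
        ext y
        simp only [s, Set.mem_ofPred_eq, Set.mem_insert_iff, ← and_assoc]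
        rw [hpre y]
        constructor
        · rintro ⟨h1 | h1, h2⟩
          · exact Or.inr ⟨h1, h2⟩
          · exact Or.inl h1
        · rintro (rfl | ⟨h1, h2⟩)
          · exact ⟨Or.inr rfl, t', ht', _, _, hso⟩
          · exact ⟨Or.inl h1, h2⟩
      rw [hns, hins, Set.ncard_insert_of_notMem (fun h => h.2.1 rfl) hfin, pow_succ]
      rw [hns, hadd, ← heq] at ihx
      rw [← ihx]
      ring
    · have hsx : s (x ++ [b]) = s x := by
        ext y
        simp only [s, Set.mem_ofPred_eq, ← and_assoc]
        rw [hpre y]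
        refine ⟨?_, fun h => ⟨Or.inl h.1, h.2⟩⟩
        rintro ⟨h1 | rfl, h2⟩
        · exact ⟨h1, h2⟩
        · exfalso
          obtain ⟨t', -, v₀, v₁, hs, hv₀, hv₁⟩ := h2
          refine h₁ ?_
          cases b
          · rw [← inter_tailRestriction_nonempty, Bool.not_false, B.S.eventualPart_eq hs.2.2.2]
            exact hv₁
          · rw [← inter_tailRestriction_nonempty, Bool.not_true, B.S.eventualPart_eq hs.2.2.1]
            exact hv₀
      rw [hns, hsx, ← hns, ← ihx, hadd]
      simp [Nat.eq_zero_of_not_pos h₁]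

theorem IsHalfSplitting.fiberCard_dyadic (hB : B.IsHalfSplitting) {π : ℕ → ℕ}
    (hπ : Function.Injective π) (ℓ : ℕ) (σ : BitSeq) (x : List Bool) :
    fiberCard (block π ℓ) (B.S.eventualPart x) σ = 0 ∨
      ∃ k, fiberCard (block π ℓ) (B.S.eventualPart x) σ = 2 ^ k := by
  rcases Nat.eq_zero_or_pos (fiberCard (block π ℓ) (B.S.eventualPart x) σ) with h | h
  · exact Or.inl h
  obtain ⟨τ, hτ, -⟩ := fiberCard_pos_iff.1 h
  obtain ⟨t, ht⟩ := B.S.exists_of_mem_eventualPart hτ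
  have := hB.fiberCard_mul_numSplitsOn hπ ht h
  obtain ⟨k, -, hk⟩ := (Nat.dvd_prime_pow Nat.prime_two).1 (Dvd.intro _ this)
  exact Or.inr ⟨k, hk⟩

theorem IsHalfSplitting.isDyadicLaminar (hB : B.IsHalfSplitting) {π : ℕ → ℕ}
    (hπ : Function.Injective π) (ℓ : ℕ) :
    IsDyadicLaminar (block π ℓ) (Set.range B.S.eventualPart) := by
  refine ⟨?_, ?_⟩
  · rintro _ ⟨x, rfl⟩ _ ⟨y, rfl⟩
    exact B.S.eventualPart_laminar x y
  · rintro C ⟨x, hx⟩ σ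
    rw [fiberCount_eq_fiberCard (nodup_block hπ ℓ), ← hx]
    exact hB.fiberCard_dyadic hπ ℓ σ x

/-- Along the prefixes of `x` the count starts at `2 ^ ℓ` and at each step stays or halves. The
first value below `2 ^ (k + 1)` is therefore `2 ^ k`. -/
theorem IsHalfSplitting.exists_fiberCard_eq (hB : B.IsHalfSplitting) {π : ℕ → ℕ}
    (hπ : Function.Injective π) {ℓ k : ℕ} (hk : k < ℓ) {σ : BitSeq} {x : List Bool}
    (hσ : σ ∈ B.S.eventualPart x)
    (h : fiberCard (block π ℓ) (B.S.eventualPart x) σ < 2 ^ (k + 1)) :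
    ∃ y, σ ∈ B.S.eventualPart y ∧ fiberCard (block π ℓ) (B.S.eventualPart y) σ = 2 ^ k := by
  induction x using List.reverseRecOn with
  | nil =>
    rw [B.S.eventualPart_nil, fiberCard_univ (nodup_block hπ ℓ), length_block] at h
    exact absurd (Nat.pow_le_pow_right (by norm_num) hk) h.not_ge
  | append_singleton x b ih =>
    by_cases hx : fiberCard (block π ℓ) (B.S.eventualPart x) σ < 2 ^ (k + 1)
    · exact ih (B.S.eventualPart_append_subset x [b] hσ) hx
    refine ⟨_, hσ, ?_⟩
    obtain ⟨t, ht⟩ := B.S.exists_of_mem_eventualPart hσ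
    have hpos : 0 < fiberCard (block π ℓ) (B.S.eventualPart (x ++ [b])) σ :=
      fiberCard_pos_iff.2 ⟨σ, hσ, self_mem_seqFiber _ _⟩
    have hle : fiberCard (block π ℓ) (B.S.eventualPart (x ++ [!b])) σ ≤
        fiberCard (block π ℓ) (B.S.eventualPart (x ++ [b])) σ := by
      rcases Nat.eq_zero_or_pos (fiberCard (block π ℓ) (B.S.eventualPart (x ++ [!b])) σ) with h0 | h0
      · omega
      · exact (hB.fiberCard_eq ht hpos h0).ge
    have hadd := fiberCard_concat_add ht (block π ℓ) σ
    rcases hB.fiberCard_dyadic hπ ℓ σ (x ++ [b]) with h0 | ⟨j, hj⟩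
    · omega
    rw [hj] at h hle hadd ⊢
    have h1 : j < k + 1 := (Nat.pow_lt_pow_iff_right (by norm_num)).1 h
    have h2 : k + 1 ≤ j + 1 := by
      refine (Nat.pow_le_pow_iff_right (a := 2) (by norm_num)).1 ?_
      rw [pow_succ 2 j]
      omega
    congr 1
    omega

theorem IsHalfSplitting.ae_le_fiberCard (hB : B.IsHalfSplitting) {π : ℕ → ℕ}
    (hπ : Function.Injective π) {g : ℕ → ℕ}
    (hg : B.SplitsUpperBounded π fun ℓ => (ℓ : ℤ) - (g ℓ : ℤ)) :
    ∀ᵐ σ ∂uniformMeasure, ∀ᶠ ℓ in atTop, ∀ x, σ ∈ B.S.eventualPart x →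
      2 ^ g ℓ ≤ fiberCard (block π ℓ) (B.S.eventualPart x) σ := by
  filter_upwards [hg] with σ hσ
  filter_upwards [hσ] with ℓ hℓ x hx
  obtain ⟨t, ht⟩ := B.S.exists_of_mem_eventualPart hx
  have h1 := hℓ t x _ ht hx
  have h2 := hB.fiberCard_mul_numSplitsOn hπ ht
    (fiberCard_pos_iff.2 ⟨σ, hx, self_mem_seqFiber (block π ℓ) σ⟩)
  refine Nat.le_of_mul_le_mul_right ?_
    (Nat.two_pow_pos (B.S.numSplitsOn (tailRestriction π ℓ σ) t x))
  rw [h2, ← pow_add]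
  exact Nat.pow_le_pow_right (by norm_num) (by omega)

end Halving

/-! ### Measures of parts and bounds on the capital -/

section Capital

theorem measure_eq_of_fiberCard_eq {V W : Set BitSeq} (hV : MeasurableSet V)
    (hW : MeasurableSet W) {P : List ℕ} (hP : P.Nodup)
    (h : ∀ σ, fiberCard P V σ = fiberCard P W σ) : uniformMeasure V = uniformMeasure W := by
  classical
  have h1 := two_pow_mul_measure_eq hV hP
  have h2 := two_pow_mul_measure_eq hW hP
  have h3 : 2 ^ P.length * uniformMeasure V = 2 ^ P.length * uniformMeasure W := by
    rw [h1, h2]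
    refine lintegral_congr fun σ => ?_
    have := h σ
    simp only [fiberCard] at this
    rw [this]
  exact (ENNReal.mul_right_inj (by simp) (by finiteness)).1 h3

/-- Replacing the first `M` bits of `σ` by those of a member of the set keeps the result in the set.
-/
theorem fiberCard_listSet_pos {C : List (List Bool)} (hne : (listSet C).Nonempty) {M : ℕ}
    (hM : ∀ c ∈ C, c.length ≤ M) (σ : BitSeq) : 0 < fiberCard (block id M) (listSet C) σ := by
  obtain ⟨τ, c, hc, hτ⟩ := hne
  refine fiberCard_pos_iff.2 ⟨fun q => if q < M then τ q else σ q, ⟨c, hc, fun i b hb => ?_⟩, ?_⟩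
  · have hi : i < c.length := (List.getElem?_eq_some_iff.1 hb).1
    change (if i < M then τ i else σ i) = b
    rw [if_pos (lt_of_lt_of_le hi (hM c hc))]
    exact hτ i b hb
  · refine mem_seqFiber.2 fun q hq => if_neg fun hqM => hq ?_
    simp [block, hqM]

theorem exists_listSet_eq (hC : B.S.IsComputable) {t : ℕ} {x : List Bool} {v : Set BitSeq}
    (hv : v ∈ B.S.part t x) : ∃ C, v = listSet C := by
  obtain ⟨F, -, hF⟩ := hC
  rw [hF, Part.mem_map_iff] at hv
  obtain ⟨C, -, rfl⟩ := hv
  exact ⟨C, rfl⟩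

theorem isOpen_eventualPart (hC : B.S.IsComputable) (x : List Bool) :
    IsOpen (B.S.eventualPart x) := by
  rcases (B.S.eventualPart x).eq_empty_or_nonempty with h | ⟨σ, hσ⟩
  · rw [h]; exact isOpen_empty
  · obtain ⟨t, ht⟩ := B.S.exists_of_mem_eventualPart hσ
    obtain ⟨C, hC⟩ := exists_listSet_eq hC ht
    rw [hC]
    exact isOpen_listSet C

/-- Take the fiber of all positions below a bound on the lengths of the strings that describe the
two parts. Every such fiber meets both parts, so half-splitting equates the counts in every fiber.
-/
theorem IsHalfSplitting.measure_concat_eq (hB : B.IsHalfSplitting) (hC : B.S.IsComputable)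
    {t : ℕ} {x : List Bool} {b : Bool} {v : Set BitSeq} (hv : v ∈ B.S.part t (x ++ [b])) :
    uniformMeasure (B.S.eventualPart (x ++ [b])) =
      uniformMeasure (B.S.eventualPart (x ++ [!b])) := by
  obtain ⟨u, hu, w, hw, -, -⟩ := B.S.exists_parent hv
  refine measure_eq_of_fiberCard_eq (isOpen_eventualPart hC _).measurableSet
    (isOpen_eventualPart hC _).measurableSet
    (P := block id ?M) (nodup_block Function.injective_id _) fun σ => ?_
  case M => exact (((exists_listSet_eq hC hv).choose ++ (exists_listSet_eq hC hw).choose).map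
    List.length).sum
  have hpos : ∀ y u (hu : u ∈ B.S.part t y) (C' : List (List Bool)),
      (∀ c ∈ (exists_listSet_eq hC hu).choose, c ∈ C') →
      0 < fiberCard (block id (C'.map List.length).sum) (B.S.eventualPart y) σ := by
    intro y u hu C' h
    have hspec := (exists_listSet_eq hC hu).choose_spec
    rw [B.S.eventualPart_eq hu]
    conv in (u) => rw [hspec]
    refine fiberCard_listSet_pos (hspec ▸ B.S.nonempty _ _ _ hu) (fun c hc => ?_) σ
    exact List.single_le_sum (by simp) _ (List.mem_map_of_mem (h c hc))
  exact hB.fiberCard_eq hv (hpos _ _ hv _ fun c hc => List.mem_append_left _ hc)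
    (hpos _ _ hw _ fun c hc => List.mem_append_right _ hc)

/-- The capital of a defined coordinate thereby becomes its mass times `2 ^ x.length`, which can be
approximated effectively. -/
theorem IsHalfSplitting.measure_eventualPart (hB : B.IsHalfSplitting) (hC : B.S.IsComputable)
    {t : ℕ} {x : List Bool} {v : Set BitSeq} (hv : v ∈ B.S.part t x) :
    uniformMeasure (B.S.eventualPart x) * 2 ^ x.length = 1 := by
  induction x using List.reverseRecOn generalizing v with
  | nil => simp [B.S.eventualPart_nil]
  | append_singleton x b ih =>
    obtain ⟨u, hu, w, hw, -, -⟩ := B.S.exists_parent hv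
    have h := ih hu
    rw [← B.S.eventualPart_concat_union hv, measure_union (B.S.disjoint_eventualPart_concat x b)
      (isOpen_eventualPart hC _).measurableSet, ← hB.measure_concat_eq hC hv] at h
    rw [← h, List.length_append, List.length_singleton, pow_succ]
    ring

theorem IsHalfSplitting.capital_eq (hB : B.IsHalfSplitting) (hC : B.S.IsComputable)
    {t : ℕ} {x : List Bool} {v : Set BitSeq} (hv : v ∈ B.S.part t x) :
    B.capital x = B.μ.toFun x * 2 ^ x.length := by
  have h := congrArg ENNReal.toNNReal (hB.measure_eventualPart hC hv)
  simp only [ENNReal.toNNReal_mul, ENNReal.toNNReal_pow, ENNReal.toNNReal_one] at h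
  rw [show ENNReal.toNNReal 2 = 2 from rfl] at h
  rw [capital, div_eq_mul_inv, inv_eq_of_mul_eq_one_right h]

theorem measure_mul_le_of_le_capital {T : ℕ} {x : List Bool} (h : (T : ℝ≥0) ≤ B.capital x) :
    uniformMeasure (B.S.eventualPart x) * T ≤ B.μ.toFun x := by
  -- On a null part, which includes undefined coordinates, the capital is the default value of a
  -- division by zero.
  rcases eq_or_ne (uniformMeasure (B.S.eventualPart x)) 0 with h0 | h0
  · rw [h0, zero_mul]; exact zero_le
  have hfin : uniformMeasure (B.S.eventualPart x) ≠ ∞ := measure_ne_top _ _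
  rw [capital, le_div_iff₀ (pos_iff_ne_zero.2 (by simp [ENNReal.toNNReal_eq_zero_iff, h0, hfin])),
    ← ENNReal.coe_le_coe, ENNReal.coe_mul, ENNReal.coe_toNNReal hfin] at h
  rw [mul_comm]
  exact_mod_cast h

/-- Ville's inequality to depth `n`. If `x` itself reaches `T`, its own part bounds the set;
otherwise the set is covered by those of the two children, whose masses add up. -/
theorem measure_le_capital_aux (T n : ℕ) (x : List Bool) :
    uniformMeasure {σ | ∃ y : List Bool, y.length ≤ n ∧ σ ∈ B.S.eventualPart (x ++ y) ∧
      (T : ℝ≥0) ≤ B.capital (x ++ y)} * T ≤ B.μ.toFun x := by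
  induction n generalizing x with
  | zero =>
    by_cases h : (T : ℝ≥0) ≤ B.capital x
    · refine le_trans (mul_le_mul_left (measure_mono ?_) _) (measure_mul_le_of_le_capital h)
      rintro σ ⟨y, -, h1, -⟩
      exact B.S.eventualPart_append_subset x y h1
    · rw [show {σ | ∃ y : List Bool, y.length ≤ 0 ∧ σ ∈ B.S.eventualPart (x ++ y) ∧
        (T : ℝ≥0) ≤ B.capital (x ++ y)} = ∅ from ?_]
      · simp
      · refine Set.eq_empty_of_forall_notMem ?_
        rintro σ ⟨y, hy, -, h2⟩
        obtain rfl : y = [] := List.eq_nil_of_length_eq_zero (by omega)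
        exact h (by simpa using h2)
  | succ n ih =>
    by_cases h : (T : ℝ≥0) ≤ B.capital x
    · refine le_trans (mul_le_mul_left (measure_mono ?_) _) (measure_mul_le_of_le_capital h)
      rintro σ ⟨y, -, h1, -⟩
      exact B.S.eventualPart_append_subset x y h1
    · rw [B.μ.additive x, ENNReal.coe_add]
      refine le_trans ?_ (add_le_add (ih (x ++ [false])) (ih (x ++ [true])))
      rw [← add_mul]
      refine mul_le_mul_left (le_trans (measure_mono ?_) (measure_union_le _ _)) _
      rintro σ ⟨y, hy, h1, h2⟩
      cases y with
      | nil => exact absurd (by simpa using h2) h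
      | cons b y =>
        rw [List.append_cons] at h1 h2
        have hyn : y.length ≤ n := by simpa using hy
        cases b
        · exact Or.inl ⟨y, hyn, h1, h2⟩
        · exact Or.inr ⟨y, hyn, h1, h2⟩

theorem measure_le_capital (B : BettingStrategy) (T : ℕ) :
    uniformMeasure {σ | ∃ x, σ ∈ B.S.eventualPart x ∧ (T : ℝ≥0) ≤ B.capital x} * T ≤
      B.μ.toFun [] := by
  have hU : {σ | ∃ x, σ ∈ B.S.eventualPart x ∧ (T : ℝ≥0) ≤ B.capital x} =
      ⋃ n : ℕ, {σ | ∃ y : List Bool, y.length ≤ n ∧ σ ∈ B.S.eventualPart ([] ++ y) ∧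
        (T : ℝ≥0) ≤ B.capital ([] ++ y)} := by
    ext σ
    simp only [Set.mem_ofPred_eq, Set.mem_iUnion, List.nil_append]
    exact ⟨fun ⟨x, h⟩ => ⟨_, x, le_rfl, h⟩, fun ⟨_, x, _, h⟩ => ⟨x, h⟩⟩
  have hmono : Monotone fun n : ℕ => {σ | ∃ y : List Bool, y.length ≤ n ∧
      σ ∈ B.S.eventualPart ([] ++ y) ∧ (T : ℝ≥0) ≤ B.capital ([] ++ y)} := by
    rintro n n' hn σ ⟨y, hy, h⟩
    exact ⟨y, hy.trans hn, h⟩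
  rw [hU, hmono.measure_iUnion, ENNReal.iSup_mul]
  exact iSup_le fun n => measure_le_capital_aux T n []

/-- All prefixes of a coordinate whose part contains `σ` also have parts containing `σ`, so the
bound passes to the maximum capital. -/
theorem not_wins_of_capital_le {σ : BitSeq} {R : ℝ≥0}
    (h : ∀ x, σ ∈ B.S.eventualPart x → B.capital x ≤ R) : ¬ B.Wins σ := by
  intro hw
  have hle : ∀ t, B.achievedCapital t σ ≤ R := by
    intro t
    refine iSup₂_le fun x hx => ?_
    obtain ⟨-, v, hv, hσ⟩ := hx
    refine ENNReal.coe_le_coe.2 (Finset.sup_le fun y hy => h y ?_)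
    obtain ⟨z, rfl⟩ := (List.mem_inits _ _).1 (List.mem_toFinset.1 hy)
    exact B.S.eventualPart_append_subset y z ⟨t, v, hv, hσ⟩
  have := le_of_tendsto' hw hle
  simp at this

end Capital

end BettingStrategy

/-! ### Computability -/

section Computability

open Primrec in
theorem primrec_strUpdate {α : Type*} [Primcodable α] {f : α → List Bool} {g : α → ℕ} (b : Bool)
    (hf : Primrec f) (hg : Primrec g) : Primrec fun a => strUpdate (f a) (g a) b :=
  Primrec.list_set.comp hf (hg.pair (Primrec.const b))

/-- The recursion varies the argument `a`; a left fold over lists of variants has the form required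
for primitive recursion. -/
theorem fiberList_eq_foldl {α : Type*} (upd : α → ℕ → Bool → α) (P : List ℕ) (a : α) :
    fiberList upd P a =
      P.foldl (fun l p => l.flatMap fun b => [upd b p false, upd b p true]) [a] := by
  have key : ∀ l : List α, P.foldl (fun l p => l.flatMap fun b => [upd b p false, upd b p true]) l =
      l.flatMap (fiberList upd P) := by
    induction P with
    | nil => intro l; simp [fiberList]
    | cons p P ih =>
      intro l
      rw [List.foldl_cons, ih, List.flatMap_assoc]
      refine congrArg (fun f => List.flatMap f l) (funext fun b => ?_)
      simp [fiberList]
  rw [key]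
  simp

theorem primrec_fiberList : Primrec₂ (fiberList strUpdate) := by
  have : Primrec₂ fun (P : List ℕ) (v : List Bool) =>
      P.foldl (fun l p => l.flatMap fun b => [strUpdate b p false, strUpdate b p true]) [v] := by
    have hstep : Primrec₂ fun (_ : List ℕ × List Bool) (r : List (List Bool) × ℕ) =>
        r.1.flatMap fun b => [strUpdate b r.2 false, strUpdate b r.2 true] := by
      refine Primrec.list_flatMap (Primrec.fst.comp Primrec.snd) ?_
      have h : ∀ b, Primrec fun q : (((List ℕ × List Bool) × (List (List Bool) × ℕ)) ×
          List Bool) => strUpdate q.2 q.1.2.2 b := fun b =>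
        primrec_strUpdate b Primrec.snd (Primrec.snd.comp (Primrec.snd.comp Primrec.fst))
      exact Primrec.list_cons.comp (h false) (Primrec.list_cons.comp (h true) (Primrec.const []))
    exact Primrec.list_foldl Primrec.fst
      (Primrec.list_cons.comp Primrec.snd (Primrec.const [])) hstep
  exact this.of_eq fun P v => (fiberList_eq_foldl _ _ _).symm

theorem primrecRel_coverTest : PrimrecRel fun (C : List (List Bool)) (v : List Bool) =>
    coverTest strPrefix C v = true := by
  have h : PrimrecRel fun (c v : List Bool) => v.take c.length = c :=
    Primrec.eq.comp (Primrec.list_take.comp (Primrec.list_length.comp Primrec.fst) Primrec.snd)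
      Primrec.fst
  refine h.exists_mem_list.of_eq fun C v => ?_
  simp [coverTest, strPrefix]

theorem primrec_fiberCount : Primrec fun q : (List ℕ × List (List Bool)) × List Bool =>
    fiberCount strUpdate strPrefix q.1.1 q.1.2 q.2 := by
  have h : Primrec₂ fun (L : List (List Bool)) (C : List (List Bool)) =>
      L.filter fun v => decide (coverTest strPrefix C v = true) :=
    PrimrecRel.listFilter (R := fun v C => coverTest strPrefix C v = true) primrecRel_coverTest.swap
  refine (Primrec.list_length.comp (h.comp (primrec_fiberList.comp (Primrec.fst.comp Primrec.fst)
    Primrec.snd) (Primrec.snd.comp Primrec.fst))).of_eq fun q => ?_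
  simp [fiberCount]

theorem primrecRel_hits : PrimrecRel fun (e : KillEvent) (q : (List ℕ × ℕ) × List Bool) =>
    hits strUpdate strPrefix q.1.1 q.1.2 e q.2 = true := by
  have hC : Primrec fun r : KillEvent × ((List ℕ × ℕ) × List Bool) => r.1.1 :=
    Primrec.fst.comp Primrec.fst
  have hQ : Primrec fun r : KillEvent × ((List ℕ × ℕ) × List Bool) => r.1.2.1 :=
    Primrec.fst.comp (Primrec.snd.comp Primrec.fst)
  have hn : Primrec fun r : KillEvent × ((List ℕ × ℕ) × List Bool) => r.1.2.2 :=
    Primrec.snd.comp (Primrec.snd.comp Primrec.fst)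
  have hP : Primrec fun r : KillEvent × ((List ℕ × ℕ) × List Bool) => r.2.1.1 :=
    Primrec.fst.comp (Primrec.fst.comp Primrec.snd)
  have hm : Primrec fun r : KillEvent × ((List ℕ × ℕ) × List Bool) => r.2.1.2 :=
    Primrec.snd.comp (Primrec.fst.comp Primrec.snd)
  have hv : Primrec fun r : KillEvent × ((List ℕ × ℕ) × List Bool) => r.2.2 :=
    Primrec.snd.comp Primrec.snd
  refine PrimrecPred.of_eq ((primrecRel_coverTest.comp hC hv).and
    ((Primrec.nat_lt.comp (primrec_fiberCount.comp ((hQ.pair hC).pair hv)) hn).and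
      (Primrec.nat_le.comp hm (primrec_fiberCount.comp ((hP.pair hC).pair hv))))) fun r => ?_
  simp [hits]

theorem primrecRel_killed :
    PrimrecRel fun (D : List KillEvent) (q : (List ℕ × ℕ) × List Bool) =>
      killed strUpdate strPrefix q.1.1 q.1.2 D q.2 = true :=
  primrecRel_hits.exists_mem_list.of_eq fun D q => by simp [killed]

/-- The data that determine a survivor test, except for the string to be tested. -/
abbrev SurvivorData : Type := ((List ℕ × ℕ) × List KillEvent) × List Bool

theorem primrec_survivor : Primrec fun q : SurvivorData × List Bool =>
    survivor strUpdate strPrefix q.1.1.1.1 q.1.1.1.2 q.1.1.2 q.1.2 q.2 := by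
  have hR : PrimrecRel fun (v : List Bool) (q : SurvivorData) =>
      v.take q.2.length = q.2 ∧ ¬ killed strUpdate strPrefix q.1.1.1 q.1.1.2 q.1.2 v = true := by
    have hs : Primrec fun r : List Bool × SurvivorData => r.2.2 := Primrec.snd.comp Primrec.snd
    have hD : Primrec fun r : List Bool × SurvivorData => r.2.1 := Primrec.fst.comp Primrec.snd
    exact PrimrecPred.and (Primrec.eq.comp
      (Primrec.list_take.comp (Primrec.list_length.comp hs) Primrec.fst) hs)
      (PrimrecPred.not (primrecRel_killed.comp (Primrec.snd.comp hD)
        ((Primrec.fst.comp hD).pair Primrec.fst)))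
  have hP : Primrec fun q : SurvivorData × List Bool => q.1.1.1.1 :=
    Primrec.fst.comp (Primrec.fst.comp (Primrec.fst.comp Primrec.fst))
  refine (Primrec.list_head?.comp (hR.listFilter.comp (primrec_fiberList.comp hP Primrec.snd)
    Primrec.fst)).of_eq fun q => ?_
  rw [List.head?_filter, survivor]
  congr 1
  funext v
  rw [Bool.eq_iff_iff]
  simp [strPrefix]

theorem primrecRel_survivorTest : PrimrecRel fun (q : SurvivorData) (v : List Bool) =>
    survivorTest q.1.1.1 q.1.1.2 q.1.2 q.2 v := by
  have hP : Primrec fun q : SurvivorData × List Bool => q.1.1.1.1 :=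
    Primrec.fst.comp (Primrec.fst.comp (Primrec.fst.comp Primrec.fst))
  have hD : Primrec fun q : SurvivorData × List Bool => q.1.1.2 :=
    Primrec.snd.comp (Primrec.fst.comp Primrec.fst)
  have hs : Primrec fun q : SurvivorData × List Bool => q.1.2 := Primrec.snd.comp Primrec.fst
  have hlt : PrimrecRel fun (p : ℕ) (v : List Bool) => p < v.length :=
    Primrec.nat_lt.comp Primrec.fst (Primrec.list_length.comp Primrec.snd)
  have hle : PrimrecRel fun (c v : List Bool) => c.length ≤ v.length :=
    Primrec.nat_le.comp (Primrec.list_length.comp Primrec.fst)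
      (Primrec.list_length.comp Primrec.snd)
  have hle' : PrimrecRel fun (e : KillEvent) (v : List Bool) => ∀ c ∈ e.1, c.length ≤ v.length :=
    hle.forall_mem_list.comp (Primrec.fst.comp Primrec.fst) Primrec.snd
  exact (Primrec.eq.comp primrec_survivor (Primrec.option_some.comp Primrec.snd)).and
    ((hlt.forall_mem_list.comp hP Primrec.snd).and
      ((hle'.forall_mem_list.comp hD Primrec.snd).and (hle.comp hs Primrec.snd)))

/-- Dovetailing: `n` encodes a number of steps and an input. -/
theorem Partrec.exists_enumeration {α β : Type*} [Primcodable α] [Primcodable β] {F : α →. β}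
    (hF : Partrec F) :
    ∃ G : ℕ → Option β, Computable G ∧ ∀ b, (∃ n, G n = some b) ↔ ∃ a, b ∈ F a := by
  obtain ⟨c, hc⟩ := Nat.Partrec.Code.exists_code.1 hF
  refine ⟨fun n => (Nat.Partrec.Code.evaln n.unpair.1 c n.unpair.2).bind Encodable.decode,
    Primrec.to_comp ?_, fun b => ?_⟩
  · refine Primrec.option_bind (Nat.Partrec.Code.primrec_evaln.comp
      (((Primrec.fst.comp Primrec.unpair).pair (Primrec.const c)).pair
        (Primrec.snd.comp Primrec.unpair))) (Primrec.decode.comp Primrec.snd)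
  · have heval : ∀ (a : ℕ) (y : ℕ), y ∈ Nat.Partrec.Code.eval c a ↔
        ∃ a', Encodable.decode a = some a' ∧ ∃ b' ∈ F a', Encodable.encode b' = y := by
      intro a y
      rw [hc, Part.mem_bind_iff]
      simp [Part.mem_map_iff]
    constructor
    · rintro ⟨n, hn⟩
      obtain ⟨y, hy, hyb⟩ := Option.bind_eq_some_iff.1 hn
      obtain ⟨a, -, b', hb', rfl⟩ := (heval _ _).1 (Nat.Partrec.Code.evaln_sound hy)
      rw [Encodable.encodek] at hyb
      exact ⟨a, Option.some.inj hyb ▸ hb'⟩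
    · rintro ⟨a, hb⟩
      obtain ⟨k, hk⟩ := Nat.Partrec.Code.evaln_complete.1
        ((heval (Encodable.encode a) (Encodable.encode b)).2 ⟨a, Encodable.encodek a, b, hb, rfl⟩)
      exact ⟨Nat.pair k (Encodable.encode a), by
        simp only [Nat.unpair_pair]; exact Option.bind_eq_some_iff.2 ⟨_, hk, Encodable.encodek b⟩⟩

/-- The kill events found from the output `r` of an enumeration of the parts of a strategy: `r`
consists of a part and its approximate capital. -/
def newEvents (T : ℕ) (blk : ℕ → List ℕ) (thr : ℕ → ℕ) (i j : ℕ)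
    (r : Option (List (List Bool) × ℕ)) : List KillEvent :=
  r.elim [] fun p => bif decide (T ≤ p.2) then
    [(p.1, blk (i + j), thr (i + j)), (p.1, blk i, 2 ^ (blk i).length + 1)]
    else [(p.1, blk (i + j), thr (i + j))]

/-- The kill events at level `i` found up to time `t`. -/
def killEvents (T : ℕ) (blk : ℕ → List ℕ) (thr : ℕ → ℕ)
    (G₁ G₂ : ℕ → Option (List (List Bool) × ℕ)) (i : ℕ) : ℕ → List KillEvent
  | 0 => []
  | t + 1 => killEvents T blk thr G₁ G₂ i t ++
      (newEvents T blk thr i t.unpair.2 (G₁ t.unpair.1) ++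
        newEvents T blk thr i t.unpair.2 (G₂ t.unpair.1))

theorem primrec_two_pow : Primrec fun n : ℕ => 2 ^ n := by
  have : Primrec fun n : ℕ => Nat.rec (motive := fun _ => ℕ) 1 (fun _ y => y * 2) n :=
    Primrec.nat_rec₁ 1 (Primrec.nat_mul.comp Primrec.snd (Primrec.const 2))
  refine this.of_eq fun n => ?_
  induction n with
  | zero => rfl
  | succ n ih => simp only [pow_succ, ← ih]

theorem computable_newEvents {T : ℕ} {blk : ℕ → List ℕ} {thr : ℕ → ℕ} (hblk : Computable blk)
    (hthr : Computable thr) {G : ℕ → Option (List (List Bool) × ℕ)} (hG : Computable G) :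
    Computable fun q : ℕ × ℕ =>
      newEvents T blk thr q.1 q.2.unpair.2 (G q.2.unpair.1) := by
  have hi : Computable fun r : (ℕ × ℕ) × (List (List Bool) × ℕ) => r.1.1 :=
    Computable.fst.comp Computable.fst
  have hij : Computable fun r : (ℕ × ℕ) × (List (List Bool) × ℕ) => r.1.1 + r.1.2.unpair.2 :=
    Primrec.nat_add.to_comp.comp hi (Computable.snd.comp (Computable.unpair.comp
      (Computable.snd.comp Computable.fst)))
  have hC : Computable fun r : (ℕ × ℕ) × (List (List Bool) × ℕ) => r.2.1 :=
    Computable.fst.comp Computable.snd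
  have hk : Computable fun r : (ℕ × ℕ) × (List (List Bool) × ℕ) => r.2.2 :=
    Computable.snd.comp Computable.snd
  have he₁ := hC.pair ((hblk.comp hij).pair (hthr.comp hij))
  have he₂ := hC.pair ((hblk.comp hi).pair (Computable.succ.comp
    (primrec_two_pow.to_comp.comp (Computable.list_length.comp (hblk.comp hi)))))
  have hd : Computable fun r : (ℕ × ℕ) × (List (List Bool) × ℕ) => decide (T ≤ r.2.2) :=
    (Primrec.nat_le.decide.to_comp.comp (Computable.const T) hk)
  have hif := Computable.cond hd
    (Computable.list_cons.comp he₁ (Computable.list_cons.comp he₂ (Computable.const [])))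
    (Computable.list_cons.comp he₁ (Computable.const []))
  refine (Computable.option_casesOn (hG.comp (Computable.fst.comp (Computable.unpair.comp
    Computable.snd))) (Computable.const ([] : List KillEvent)) hif.to₂).of_eq fun q => ?_
  cases h : G q.2.unpair.1 <;> simp [newEvents]

theorem computable_killEvents {T : ℕ} {blk : ℕ → List ℕ} {thr : ℕ → ℕ} (hblk : Computable blk)
    (hthr : Computable thr) {G₁ G₂ : ℕ → Option (List (List Bool) × ℕ)} (hG₁ : Computable G₁)
    (hG₂ : Computable G₂) : Computable₂ (killEvents T blk thr G₁ G₂) := by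
  have hp : Computable fun r : (ℕ × ℕ) × (ℕ × List KillEvent) => (r.1.1, r.2.1) :=
    (Computable.fst.comp Computable.fst).pair (Computable.fst.comp Computable.snd)
  have := Computable.nat_rec (f := fun q : ℕ × ℕ => q.2) (g := fun _ => ([] : List KillEvent))
    Computable.snd (Computable.const [])
    (Computable.list_append.comp (Computable.snd.comp Computable.snd)
      (Computable.list_append.comp ((computable_newEvents (T := T) hblk hthr hG₁).comp hp)
        ((computable_newEvents (T := T) hblk hthr hG₂).comp hp))).to₂
  refine this.of_eq fun q => ?_
  obtain ⟨i, t⟩ := q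
  induction t with
  | zero => rfl
  | succ t ih => simp only [killEvents, ← ih]

theorem killEvents_subset {T : ℕ} {blk : ℕ → List ℕ} {thr : ℕ → ℕ}
    {G₁ G₂ : ℕ → Option (List (List Bool) × ℕ)} {i t t' : ℕ} (h : t ≤ t') :
    killEvents T blk thr G₁ G₂ i t ⊆ killEvents T blk thr G₁ G₂ i t' := by
  induction t', h using Nat.le_induction with
  | base => exact fun _ h => h
  | succ t' _ ih => exact fun e he => List.mem_append_left _ (ih he)

theorem mem_killEvents {T : ℕ} {blk : ℕ → List ℕ} {thr : ℕ → ℕ}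
    {G₁ G₂ : ℕ → Option (List (List Bool) × ℕ)} {i : ℕ} {e : KillEvent} :
    (∃ t, e ∈ killEvents T blk thr G₁ G₂ i t) ↔
      ∃ n C k, (G₁ n = some (C, k) ∨ G₂ n = some (C, k)) ∧
        ((∃ j, e = (C, blk (i + j), thr (i + j))) ∨
          (T ≤ k ∧ e = (C, blk i, 2 ^ (blk i).length + 1))) := by
  have hnew : ∀ j r, e ∈ newEvents T blk thr i j r ↔ ∃ C k, r = some (C, k) ∧
      (e = (C, blk (i + j), thr (i + j)) ∨ (T ≤ k ∧ e = (C, blk i, 2 ^ (blk i).length + 1))) := by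
    intro j r
    cases r with
    | none => simp [newEvents]
    | some p =>
      obtain ⟨C, k⟩ := p
      by_cases hT : T ≤ k
      · simp only [newEvents, Option.elim_some, hT, decide_true, cond_true, List.mem_cons,
          List.not_mem_nil, or_false, Option.some.injEq, Prod.mk.injEq]
        constructor
        · intro h; exact ⟨C, k, ⟨rfl, rfl⟩, h.imp_right fun h => ⟨hT, h⟩⟩
        · rintro ⟨_, _, ⟨rfl, rfl⟩, h⟩; exact h.imp_right fun h => h.2
      · simp only [newEvents, Option.elim_some, hT, decide_false, cond_false, List.mem_cons,
          List.not_mem_nil, or_false, Option.some.injEq, Prod.mk.injEq]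
        constructor
        · intro h; exact ⟨C, k, ⟨rfl, rfl⟩, Or.inl h⟩
        · rintro ⟨_, _, ⟨rfl, rfl⟩, h⟩; exact h.resolve_right fun h => hT h.1
  constructor
  · rintro ⟨t, ht⟩
    induction t with
    | zero => simp [killEvents] at ht
    | succ t ih =>
      rw [killEvents, List.mem_append, List.mem_append, hnew, hnew] at ht
      rcases ht with h | ⟨C, k, hG, h⟩ | ⟨C, k, hG, h⟩
      · exact ih h
      · exact ⟨_, C, k, Or.inl hG, h.imp_left fun h => ⟨_, h⟩⟩
      · exact ⟨_, C, k, Or.inr hG, h.imp_left fun h => ⟨_, h⟩⟩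
  · rintro ⟨n, C, k, hG, h⟩
    obtain ⟨j, hj⟩ : ∃ j, e = (C, blk (i + j), thr (i + j)) ∨
        (T ≤ k ∧ e = (C, blk i, 2 ^ (blk i).length + 1)) := by
      rcases h with ⟨j, h⟩ | h
      · exact ⟨j, Or.inl h⟩
      -- The capital event is emitted for every `j`, so any value serves.
      · exact ⟨0, Or.inr h⟩
    refine ⟨Nat.pair n j + 1, ?_⟩
    rw [killEvents, List.mem_append, List.mem_append, hnew, hnew, Nat.unpair_pair]
    exact Or.inr (hG.imp (fun hG => ⟨C, k, hG, hj⟩) (fun hG => ⟨C, k, hG, hj⟩))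

theorem computable_block {π : ℕ → ℕ} (hπ : Computable π) : Computable (block π) := by
  have := Computable.nat_rec (f := fun n : ℕ => n) (g := fun _ => ([] : List ℕ))
    Computable.id (Computable.const [])
    (Computable.list_append.comp (Computable.snd.comp Computable.snd)
      (Computable.list_cons.comp (hπ.comp (Computable.fst.comp Computable.snd))
        (Computable.const []))).to₂ (h := fun _ q => q.2 ++ [π q.1])
  refine this.of_eq fun n => ?_
  induction n with
  | zero => rfl
  | succ n ih => simp only [block, List.range_succ, List.map_append, List.map_cons,
      List.map_nil] at ih ⊢; rw [← ih]

end Computability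

/-! ### Martin-Löf tests from Solovay-type tests -/

section Test

/-- Borel–Cantelli: the unions of the levels from `n` on are nested and have measure at most `2⁻¹ ^
(n + 1)`. -/
theorem not_isMartinLofRandom_of_frequently {F : ℕ → ℕ → List Bool} (hF : Computable₂ F)
    (hm : ∀ i, uniformMeasure (testLevel F i) ≤ (2⁻¹ : ℝ≥0∞) ^ (i + 2)) {σ : BitSeq}
    (hσ : ∃ᶠ i in atTop, σ ∈ testLevel F i) : ¬ IsMartinLofRandom σ := by
  let f : ℕ → ℕ → List Bool := fun n k => F (n + k.unpair.1) k.unpair.2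
  have hf : ∀ n, testLevel f n = ⋃ i, testLevel F (n + i) := by
    intro n
    ext τ
    simp only [testLevel, Set.mem_iUnion, f]
    constructor
    · rintro ⟨k, hk⟩; exact ⟨_, _, hk⟩
    · rintro ⟨i, k, hk⟩; exact ⟨Nat.pair i k, by simpa [Nat.unpair_pair] using hk⟩
  have hfre := frequently_atTop.1 hσ
  refine not_not.2 ⟨f, ⟨?_, fun n => ?_, fun n => ?_⟩, fun n => ?_⟩
  · have hk : Computable fun q : ℕ × ℕ => q.2.unpair := Computable.unpair.comp Computable.snd
    exact hF.comp (Primrec.nat_add.to_comp.comp Computable.fst (Computable.fst.comp hk))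
      (Computable.snd.comp hk)
  · rw [hf]
    calc uniformMeasure (⋃ i, testLevel F (n + i))
        ≤ ∑' i, uniformMeasure (testLevel F (n + i)) := measure_iUnion_le _
      _ ≤ ∑' i : ℕ, (2⁻¹ : ℝ≥0∞) ^ (n + 2) * 2⁻¹ ^ i := by
          refine ENNReal.tsum_le_tsum fun i => (hm _).trans_eq ?_
          rw [← pow_add]
          congr 1
          omega
      _ = (2⁻¹ : ℝ≥0∞) ^ n * 2⁻¹ := by
          rw [ENNReal.tsum_mul_left, ENNReal.tsum_geometric, ENNReal.one_sub_inv_two, inv_inv,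
            pow_add, pow_two, mul_assoc, mul_assoc, ENNReal.inv_mul_cancel (by simp) (by simp),
            mul_one]
      _ < (2⁻¹ : ℝ≥0∞) ^ n := by
          conv_rhs => rw [← mul_one ((2⁻¹ : ℝ≥0∞) ^ n)]
          exact (ENNReal.mul_lt_mul_iff_right (by simp) (by finiteness)).2 ENNReal.one_half_lt_one
  · rw [hf, hf]
    refine Set.iUnion_subset fun i => ?_
    rw [Nat.add_assoc]
    exact Set.subset_iUnion (fun i => testLevel F (n + i)) (1 + i)
  · obtain ⟨i, hi, h⟩ := hfre n
    rw [hf]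
    exact Set.mem_iUnion.2 ⟨i - n, by rwa [Nat.add_sub_cancel' hi]⟩

theorem measure_basicSet_replicate (n : ℕ) :
    uniformMeasure (basicSet (List.replicate n false)) = (2⁻¹ : ℝ≥0∞) ^ n := by
  have : basicSet (List.replicate n false) =
      Set.pi (Finset.range n : Set ℕ) fun _ => ({false} : Set Bool) := by
    ext σ
    simp only [basicSet, Set.mem_ofPred_eq, List.getElem?_replicate, Set.mem_pi, Finset.mem_coe,
      Finset.mem_range, Set.mem_singleton_iff]
    constructor
    · intro h i hi
      exact h i false (by rw [if_pos hi])
    · intro h i b hb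
      split_ifs at hb with hi
      rw [h i hi]
      exact Option.some.inj hb
  rw [this, uniformMeasure, Measure.infinitePi_pi _ (fun _ _ => MeasurableSet.of_discrete)]
  simp

end Test

/-! ### Enumerating parts with their capitals, and a sequence with large parts and bounded capital
-/

namespace BettingStrategy

/-- `G` enumerates the parts of the betting strategy together with approximations of their
capitals. -/
structure IsPartEnumeration (B : BettingStrategy) (G : ℕ → Option (List (List Bool) × ℕ)) :
    Prop where
  sound : ∀ n C k, G n = some (C, k) →
    ∃ x, listSet C = B.S.eventualPart x ∧ |(k : ℝ) - B.capital x| ≤ 1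
  complete : ∀ x, ∀ σ ∈ B.S.eventualPart x, ∃ n C k, G n = some (C, k) ∧
    listSet C = B.S.eventualPart x ∧ |(k : ℝ) - B.capital x| ≤ 1

theorem exists_isPartEnumeration {B : BettingStrategy} (hC : B.IsComputable)
    (hB : B.IsHalfSplitting) : ∃ G, Computable G ∧ B.IsPartEnumeration G := by
  obtain ⟨F, hF, hS⟩ := hC.1
  obtain ⟨q, hq, hμ⟩ := hC.2
  have hH : Partrec fun p : ℕ × List Bool =>
      (F p.1 p.2).bind fun C => (q p.2 p.2.length).map fun k => (C, k) := by
    refine Partrec.bind hF ?_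
    have hx : Computable fun r : (ℕ × List Bool) × List (List Bool) => r.1.2 :=
      Computable.snd.comp Computable.fst
    exact Partrec.map (hq.comp hx (Computable.list_length.comp hx))
      ((Computable.snd.comp Computable.fst).pair Computable.snd).to₂
  obtain ⟨G, hG, hGs⟩ := Partrec.exists_enumeration hH
  have hpart : ∀ t x C, C ∈ F t x → listSet C ∈ B.S.part t x := by
    intro t x C h
    rw [hS, Part.mem_map_iff]
    exact ⟨C, h, rfl⟩
  have hcap : ∀ t x C k, C ∈ F t x → k ∈ q x x.length → |(k : ℝ) - B.capital x| ≤ 1 := by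
    intro t x C k h hk
    have h1 := hpart t x C h
    -- With precision `x.length`, multiplying by `2 ^ x.length` turns the error of the mass into an
    -- error of at most 1 of the capital, so the numerator itself approximates the capital.
    obtain ⟨k', hk', hle⟩ := hμ t x (Part.dom_iff_mem.2 ⟨_, h1⟩) x.length
    rw [Part.mem_unique hk hk', hB.capital_eq hC.1 h1]
    push_cast
    have hpos : (0 : ℝ) < 2 ^ x.length := by positivity
    rw [le_div_iff₀ hpos] at hle
    calc |(k' : ℝ) - B.μ.toFun x * 2 ^ x.length|
        = |((k' : ℝ) / 2 ^ x.length - B.μ.toFun x) * 2 ^ x.length| := by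
          rw [sub_mul, div_mul_cancel₀ _ hpos.ne']
      _ = |(k' : ℝ) / 2 ^ x.length - B.μ.toFun x| * 2 ^ x.length := by
          rw [abs_mul, abs_of_pos hpos]
      _ ≤ 1 := hle
  refine ⟨G, hG, ⟨fun n C k h => ?_, fun x σ hσ => ?_⟩⟩
  · obtain ⟨⟨t, x⟩, hm⟩ := (hGs (C, k)).1 ⟨n, h⟩
    obtain ⟨C', hC', hm⟩ := Part.mem_bind_iff.1 hm
    obtain ⟨k', hk', heq⟩ := (Part.mem_map_iff _).1 hm
    obtain ⟨rfl, rfl⟩ := Prod.mk.inj heq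
    exact ⟨x, (B.S.eventualPart_eq (hpart t x _ hC')).symm, hcap t x _ _ hC' hk'⟩
  · obtain ⟨t, ht⟩ := B.S.exists_of_mem_eventualPart hσ
    obtain ⟨k, hk, -⟩ := hμ t x (Part.dom_iff_mem.2 ⟨_, ht⟩) x.length
    rw [hS, Part.mem_map_iff] at ht
    obtain ⟨C, hC', hCeq⟩ := ht
    obtain ⟨n, hn⟩ := (hGs (C, k)).2 ⟨(t, x), Part.mem_bind_iff.2 ⟨C, hC',
      (Part.mem_map_iff _).2 ⟨k, hk, rfl⟩⟩⟩
    exact ⟨n, C, k, hn, hCeq, hcap t x C k hC' hk⟩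

/-- The sequences with large parts from `L` on increase with `L` to a set of full measure, so one of
these sets exceeds measure `1 / 2`. By Ville's inequality each strategy spoils at most `1 / 4` by
reaching capital `T + 1`. -/
theorem exists_forall_le_fiberCard {A B : BettingStrategy} (hA : A.IsHalfSplitting)
    (hB : B.IsHalfSplitting) {π : ℕ → ℕ} (hπ : Function.Injective π) {g : ℕ → ℕ}
    (hgA : A.SplitsUpperBounded π fun ℓ => (ℓ : ℤ) - (g ℓ : ℤ))
    (hgB : B.SplitsUpperBounded π fun ℓ => (ℓ : ℤ) - (g ℓ : ℤ)) :
    ∃ (T L : ℕ) (σ : BitSeq), ∀ X ∈ ({A, B} : Set BettingStrategy), ∀ x,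
      σ ∈ X.S.eventualPart x → X.capital x < T ∧
        ∀ ℓ ≥ L, 2 ^ g ℓ ≤ fiberCard (block π ℓ) (X.S.eventualPart x) σ := by
  let Z : ℕ → Set BitSeq := fun L => {σ | ∀ ℓ ≥ L, ∀ X ∈ ({A, B} : Set BettingStrategy), ∀ x,
    σ ∈ X.S.eventualPart x → 2 ^ g ℓ ≤ fiberCard (block π ℓ) (X.S.eventualPart x) σ}
  have hZmono : Monotone Z := fun L L' h σ hσ ℓ hℓ => hσ ℓ (h.trans hℓ)
  have hZ : uniformMeasure (⋃ L, Z L) = 1 := by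
    have hae : ∀ᵐ σ ∂uniformMeasure, σ ∈ ⋃ L, Z L := by
      filter_upwards [hA.ae_le_fiberCard hπ hgA, hB.ae_le_fiberCard hπ hgB] with σ h₁ h₂
      obtain ⟨L, hL⟩ := eventually_atTop.1 (h₁.and h₂)
      refine Set.mem_iUnion.2 ⟨L, fun ℓ hℓ X hX => ?_⟩
      rcases hX with rfl | rfl
      · exact (hL ℓ hℓ).1
      · exact (hL ℓ hℓ).2
    rw [measure_congr (s := ⋃ L, Z L) (t := Set.univ) (eventuallyEq_univ.2 hae), measure_univ]
  obtain ⟨L, hL⟩ : ∃ L, 2⁻¹ < uniformMeasure (Z L) := by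
    rw [hZmono.measure_iUnion] at hZ
    refine lt_iSup_iff.1 ?_
    rw [hZ]
    exact ENNReal.one_half_lt_one
  obtain ⟨T, hTA, hTB⟩ : ∃ T : ℕ, 4 * A.μ.toFun [] ≤ T ∧ 4 * B.μ.toFun [] ≤ T := by
    obtain ⟨T, hT⟩ := exists_nat_ge (max (4 * A.μ.toFun []) (4 * B.μ.toFun []))
    exact ⟨T, (le_max_left _ _).trans hT, (le_max_right _ _).trans hT⟩
  let K : BettingStrategy → Set BitSeq := fun X =>
    {σ | ∃ x, σ ∈ X.S.eventualPart x ∧ ((T + 1 : ℕ) : ℝ≥0) ≤ X.capital x}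
  have hK : ∀ X : BettingStrategy, 4 * X.μ.toFun [] ≤ T → uniformMeasure (K X) ≤ 4⁻¹ := by
    intro X hX
    have h1 := X.measure_le_capital (T + 1)
    have h2 : uniformMeasure (K X) * 4 * (T + 1 : ℕ) ≤ (1 : ℝ≥0∞) * (T + 1 : ℕ) := by
      calc uniformMeasure (K X) * 4 * (T + 1 : ℕ) = 4 * (uniformMeasure (K X) * (T + 1 : ℕ)) := by
            ring
        _ ≤ 4 * X.μ.toFun [] := by gcongr
        _ ≤ (T : ℝ≥0∞) := by exact_mod_cast hX
        _ ≤ (1 : ℝ≥0∞) * (T + 1 : ℕ) := by rw [one_mul]; exact_mod_cast Nat.le_succ T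
    have h3 := (ENNReal.mul_le_mul_iff_left (by simp) (by finiteness)).1 h2
    rwa [← ENNReal.le_div_iff_mul_le (by simp) (by simp), one_div] at h3
  obtain ⟨σ, hσZ, hσK⟩ : ∃ σ ∈ Z L, σ ∉ K A ∪ K B := by
    by_contra! hcon
    have h1 : uniformMeasure (Z L) ≤ 4⁻¹ + 4⁻¹ :=
      (measure_mono hcon).trans ((measure_union_le _ _).trans (add_le_add (hK A hTA) (hK B hTB)))
    have h2 : (4⁻¹ + 4⁻¹ : ℝ≥0∞) = 2⁻¹ := by
      rw [← two_mul, show (4 : ℝ≥0∞) = 2 * 2 by norm_num,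
        ENNReal.mul_inv (by simp) (by simp), ← mul_assoc, ENNReal.mul_inv_cancel (by simp) (by simp),
        one_mul]
    rw [h2] at h1
    exact absurd hL h1.not_gt
  refine ⟨T + 1, L, σ, fun X hX x hx => ⟨?_, fun ℓ hℓ => hσZ ℓ hℓ X hX x hx⟩⟩
  by_contra! hcon
  rcases hX with rfl | rfl
  · exact hσK (Or.inl ⟨x, hx, hcon⟩)
  · exact hσK (Or.inr ⟨x, hx, hcon⟩)

end BettingStrategy

/-! ### The sequence on which neither strategy wins -/

section Levels

/-- The string attached to the `i`-th level. -/
def levelString (i : ℕ) : List Bool := ((Encodable.decode i : Option (List Bool))).getD []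

theorem computable_levelString : Computable levelString :=
  Computable.option_getD Computable.decode (Computable.const [])

theorem levelString_encode (s : List Bool) : levelString (Encodable.encode s) = s := by
  simp [levelString]

/-- Taking the least suitable level makes `lev` monotone, so the blocks of later levels contain the
earlier ones. -/
theorem exists_computable_levels {g : ℕ → ℕ} (hg : Computable g) (hgu : ∀ K, ∃ ℓ, K ≤ g ℓ)
    (L : ℕ) : ∃ lev : ℕ → ℕ, Computable lev ∧ Monotone lev ∧ (∀ i, L ≤ lev i) ∧
      ∀ i, i + 6 ≤ g (lev i) := by
  have hex : ∀ i, ∃ n, i + 6 ≤ g (L + n) := by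
    intro i
    -- The demanded value exceeds all values of `g` below `L`, which forces `L ≤ ℓ`.
    obtain ⟨ℓ, hℓ⟩ := hgu (i + 6 + (Finset.range L).sup g + 1)
    have hL : L ≤ ℓ := by
      by_contra! h
      have := Finset.le_sup (f := g) (Finset.mem_range.2 h)
      omega
    exact ⟨ℓ - L, by rw [Nat.add_sub_cancel' hL]; omega⟩
  have hadd : Computable fun n : ℕ => L + n :=
    Primrec.nat_add.to_comp.comp (Computable.const L) Computable.id
  have hc : ComputablePred fun p : ℕ × ℕ => p.1 + 6 ≤ g (L + p.2) := by
    refine Computable.computablePred (Primrec.nat_le.decide.to_comp.comp ?_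
      (hg.comp (hadd.comp Computable.snd)))
    exact Primrec.nat_add.to_comp.comp Computable.fst (Computable.const 6)
  refine ⟨fun i => L + Nat.find (hex i), hadd.comp (Computable.find hc hex), fun i i' h => ?_,
    fun i => Nat.le_add_right _ _, fun i => Nat.find_spec (hex i)⟩
  refine Nat.add_le_add_left (Nat.find_min' _ ?_) L
  have := Nat.find_spec (hex i')
  omega

end Levels

/-! ### Safe sequences, the Baire category argument and the conclusion -/

section Main

/-- The parts with their approximate capitals that are enumerated by `G₁` or by `G₂`. -/
def IsEnumerated (G₁ G₂ : ℕ → Option (List (List Bool) × ℕ)) (C : List (List Bool)) (k : ℕ) :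
    Prop :=
  ∃ n, G₁ n = some (C, k) ∨ G₂ n = some (C, k)

/-- The sequences that are not killed at level `i`. -/
def safeSet (T : ℕ) (blk : ℕ → List ℕ) (thr : ℕ → ℕ)
    (G₁ G₂ : ℕ → Option (List (List Bool) × ℕ)) (i : ℕ) : Set BitSeq :=
  {σ | ∀ C k, IsEnumerated G₁ G₂ C k → σ ∈ listSet C →
    k < T ∧ ∀ j, thr (i + j) ≤ fiberCard (blk (i + j)) (listSet C) σ}

theorem safeSet_mono {T : ℕ} {blk : ℕ → List ℕ} {thr : ℕ → ℕ}
    {G₁ G₂ : ℕ → Option (List (List Bool) × ℕ)} :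
    Monotone (safeSet T blk thr G₁ G₂) := by
  intro i i' h σ hσ C k hC hσC
  obtain ⟨h1, h2⟩ := hσ C k hC hσC
  refine ⟨h1, fun j => ?_⟩
  have := h2 (i' - i + j)
  rwa [← Nat.add_assoc, Nat.add_sub_cancel' h] at this

/-- Exempting parts with fewer than `2 ^ e i` elements in the fiber loses no kills. Around `σ`, such
a part lies below a part of the same strategy with exactly `2 ^ e i` elements, which is not exempt
and violates the threshold `2 ^ (e i + 1)`. -/
theorem mem_safeSet_iff {A B : BettingStrategy} {G₁ G₂ : ℕ → Option (List (List Bool) × ℕ)}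
    (hA : A.IsHalfSplitting) (hB : B.IsHalfSplitting) (hG₁ : A.IsPartEnumeration G₁)
    (hG₂ : B.IsPartEnumeration G₂) {π : ℕ → ℕ} (hπ : Function.Injective π) {lev e : ℕ → ℕ}
    (he : ∀ i, e i < lev i) (T i : ℕ) {σ : BitSeq} :
    σ ∈ safeSet T (fun i => block π (lev i)) (fun i => 2 ^ (e i + 1)) G₁ G₂ i ↔
      ∀ t, killed seqUpdate seqPrefix (block π (lev i)) (2 ^ e i)
        (killEvents T (fun i => block π (lev i)) (fun i => 2 ^ (e i + 1)) G₁ G₂ i t) σ = false := by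
  have hkill : (∃ t, killed seqUpdate seqPrefix (block π (lev i)) (2 ^ e i)
      (killEvents T (fun i => block π (lev i)) (fun i => 2 ^ (e i + 1)) G₁ G₂ i t) σ = true) ↔
      ∃ C k, IsEnumerated G₁ G₂ C k ∧ σ ∈ listSet C ∧
        2 ^ e i ≤ fiberCard (block π (lev i)) (listSet C) σ ∧
        (T ≤ k ∨ ∃ j, fiberCard (block π (lev (i + j))) (listSet C) σ < 2 ^ (e (i + j) + 1)) := by
    simp only [killed, List.any_eq_true]
    constructor
    · rintro ⟨t, ev, hev, hh⟩
      obtain ⟨n, C, k, hG, h⟩ := mem_killEvents.1 ⟨t, hev⟩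
      rw [hits_seq_iff] at hh
      rcases h with ⟨j, rfl⟩ | ⟨hT, rfl⟩
      · simp only [fiberCount_eq_fiberCard (nodup_block hπ _)] at hh
        exact ⟨C, k, ⟨n, hG⟩, hh.1, hh.2.2, Or.inr ⟨j, hh.2.1⟩⟩
      · simp only [fiberCount_eq_fiberCard (nodup_block hπ _)] at hh
        exact ⟨C, k, ⟨n, hG⟩, hh.1, hh.2.2, Or.inl hT⟩
    · rintro ⟨C, k, ⟨n, hG⟩, hσ, hle, h⟩
      have hex : ∃ ev : KillEvent, ((∃ j, ev = (C, block π (lev (i + j)), 2 ^ (e (i + j) + 1))) ∨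
          (T ≤ k ∧ ev = (C, block π (lev i), 2 ^ (block π (lev i)).length + 1))) ∧
          hits seqUpdate seqPrefix (block π (lev i)) (2 ^ e i) ev σ = true := by
        rcases h with hT | ⟨j, hj⟩
        -- The threshold of a capital event exceeds the size of the whole fiber, so its count
        -- condition always holds.
        · refine ⟨_, Or.inr ⟨hT, rfl⟩, ?_⟩
          rw [hits_seq_iff]
          simp only [fiberCount_eq_fiberCard (nodup_block hπ _)]
          refine ⟨hσ, Nat.lt_succ_of_le ?_, hle⟩
          rw [← fiberCount_eq_fiberCard (nodup_block hπ _), fiberCount,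
            ← length_fiberList seqUpdate _ σ]
          exact List.length_filter_le _ _
        · refine ⟨_, Or.inl ⟨j, rfl⟩, ?_⟩
          rw [hits_seq_iff]
          simp only [fiberCount_eq_fiberCard (nodup_block hπ _)]
          exact ⟨hσ, hj, hle⟩
      obtain ⟨ev, hev, hh⟩ := hex
      obtain ⟨t, ht⟩ := (mem_killEvents (blk := fun i => block π (lev i))
        (thr := fun i => 2 ^ (e i + 1))).2 ⟨n, C, k, hG, hev⟩
      exact ⟨t, ev, ht, hh⟩
  have hsmall : ∀ C k, IsEnumerated G₁ G₂ C k → σ ∈ listSet C →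
      fiberCard (block π (lev i)) (listSet C) σ < 2 ^ (e i + 1) →
      ∃ C' k', IsEnumerated G₁ G₂ C' k' ∧ σ ∈ listSet C' ∧
        fiberCard (block π (lev i)) (listSet C') σ = 2 ^ e i := by
    rintro C k ⟨n, hn⟩ hσ hlt
    rcases hn with hn | hn
    · obtain ⟨x, hx, -⟩ := hG₁.sound n C k hn
      rw [hx] at hσ hlt
      obtain ⟨y, hy, hcard⟩ := hA.exists_fiberCard_eq hπ (he i) hσ hlt
      obtain ⟨n', C', k', hn', hC', -⟩ := hG₁.complete y σ hy
      exact ⟨C', k', ⟨n', Or.inl hn'⟩, hC' ▸ hy, hC' ▸ hcard⟩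
    · obtain ⟨x, hx, -⟩ := hG₂.sound n C k hn
      rw [hx] at hσ hlt
      obtain ⟨y, hy, hcard⟩ := hB.exists_fiberCard_eq hπ (he i) hσ hlt
      obtain ⟨n', C', k', hn', hC', -⟩ := hG₂.complete y σ hy
      exact ⟨C', k', ⟨n', Or.inr hn'⟩, hC' ▸ hy, hC' ▸ hcard⟩
  constructor
  · intro hσ t
    by_contra hcon
    obtain ⟨C, k, hC, hσC, -, h⟩ := hkill.1 ⟨t, by simpa using hcon⟩
    obtain ⟨h1, h2⟩ := hσ C k hC hσC
    rcases h with h | ⟨j, h⟩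
    · omega
    · exact absurd (h2 j) h.not_ge
  · intro hσ C k hC hσC
    by_contra hcon
    rw [not_and_or, not_lt] at hcon
    push Not at hcon
    obtain ⟨t, ht⟩ : ∃ t, killed seqUpdate seqPrefix (block π (lev i)) (2 ^ e i)
        (killEvents T (fun i => block π (lev i)) (fun i => 2 ^ (e i + 1)) G₁ G₂ i t) σ = true := by
      rw [hkill]
      by_cases hlt : fiberCard (block π (lev i)) (listSet C) σ < 2 ^ (e i + 1)
      · obtain ⟨C', k', hC', hσC', hcard⟩ := hsmall C k hC hσC hlt
        refine ⟨C', k', hC', hσC', hcard.ge, Or.inr ⟨0, ?_⟩⟩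
        rw [Nat.add_zero, hcard]
        exact Nat.pow_lt_pow_right (by norm_num) (Nat.lt_succ_self _)
      · refine ⟨C, k, hC, hσC, ?_, hcon⟩
        exact le_trans (Nat.pow_le_pow_right (by norm_num) (Nat.le_succ _)) (not_lt.1 hlt)
    rw [hσ t] at ht
    exact absurd ht (by simp)

/-- Baire category in the compact space `Y`: the tail unions of the `U i` are open, and they are
dense because `U i` reaches into every basic set `basicSet (levelString i)` that meets `W i`. -/
theorem exists_mem_closure_frequently {W : ℕ → Set BitSeq} (hW : Monotone W)
    (hne : (W 0).Nonempty) {U : ℕ → Set BitSeq} (hU : ∀ i, IsOpen (U i))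
    (hWU : ∀ i, (W i ∩ basicSet (levelString i)).Nonempty →
      (U i ∩ W i ∩ basicSet (levelString i)).Nonempty) :
    ∃ σ ∈ closure (⋃ i, W i), ∃ᶠ i in atTop, σ ∈ U i := by
  let Y : Set BitSeq := closure (⋃ i, W i)
  let V : ℕ → Set BitSeq := fun n => ⋃ i ≥ n, U i
  have hV : ∀ n, IsOpen (V n) := fun n => isOpen_biUnion fun i _ => hU i
  have hcomp : CompactSpace Y := isCompact_iff_compactSpace.1 isClosed_closure.isCompact
  have hY : Nonempty Y := by
    obtain ⟨σ, hσ⟩ := hne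
    exact ⟨⟨σ, subset_closure (Set.mem_iUnion.2 ⟨0, hσ⟩)⟩⟩
  have hdense : ∀ n, Dense ((Subtype.val : Y → BitSeq) ⁻¹' V n) := by
    intro n
    rw [Subtype.dense_iff]
    refine closure_minimal ?_ isClosed_closure
    intro y hy
    obtain ⟨i, hi⟩ := Set.mem_iUnion.1 hy
    rw [mem_closure_iff]
    intro O hO hyO
    obtain ⟨M₀, hM₀⟩ := exists_basicSet_subset hO hyO
    -- The prefixes of `y` have distinct codes, so long prefixes occur as level strings at
    -- arbitrarily large indices.
    have hinj : Function.Injective fun M => Encodable.encode (truncSeq M y) := by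
      intro M M' h
      have := congrArg List.length (Encodable.encode_injective h)
      simpa using this
    have htend : Tendsto (fun M => Encodable.encode (truncSeq M y)) atTop atTop :=
      hinj.nat_tendsto_atTop
    obtain ⟨M, hM, hMi⟩ := ((eventually_ge_atTop M₀).and
      (htend.eventually_ge_atTop (max n i))).exists
    obtain ⟨τ, ⟨hτU, hτW⟩, hτs⟩ := hWU (Encodable.encode (truncSeq M y))
      ⟨y, hW (le_trans (le_max_right n i) hMi) hi, by
        rw [levelString_encode]; exact mem_basicSet_truncSeq M y⟩
    rw [levelString_encode] at hτs
    refine ⟨τ, hM₀ M hM hτs, ⟨τ, subset_closure (Set.mem_iUnion.2 ⟨_, hτW⟩)⟩, ?_, rfl⟩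
    exact Set.mem_biUnion (le_trans (le_max_left n i) hMi) hτU
  have hfin := dense_iInter_of_isOpen_nat (fun n => (hV n).preimage continuous_subtype_val) hdense
  obtain ⟨⟨σ, hσY⟩, hσ⟩ := hfin.nonempty
  refine ⟨σ, hσY, frequently_atTop.2 fun n => ?_⟩
  have h := Set.mem_iInter.1 hσ n
  simp only [Set.mem_preimage, V, Set.mem_iUnion] at h
  obtain ⟨i, hi, h⟩ := h
  exact ⟨i, hi, h⟩

open Classical in
/-- The `k`-th string enumerated at the `i`-th level: with `k` encoding a time and a string, it is
this string if it passes the survivor test, and otherwise a string of zeros. -/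
noncomputable def levelEnum (data : ℕ → ℕ → SurvivorData) (i k : ℕ) : List Bool :=
  if survivorTest (data i k.unpair.1).1.1.1 (data i k.unpair.1).1.1.2 (data i k.unpair.1).1.2
    (data i k.unpair.1).2 (levelString k.unpair.2) then levelString k.unpair.2
  else List.replicate (i + 3) false

theorem computable_levelEnum {data : ℕ → ℕ → SurvivorData} (hd : Computable₂ data) :
    Computable₂ (levelEnum data) := by
  classical
  have hk : Computable fun q : ℕ × ℕ => q.2.unpair := Computable.unpair.comp Computable.snd
  have hv : Computable fun q : ℕ × ℕ => levelString q.2.unpair.2 :=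
    computable_levelString.comp (Computable.snd.comp hk)
  have ht : Computable fun q : ℕ × ℕ => data q.1 q.2.unpair.1 :=
    hd.comp Computable.fst (Computable.fst.comp hk)
  have hz : Computable fun q : ℕ × ℕ => List.replicate (q.1 + 3) false := by
    have h1 : Primrec fun n : ℕ => (List.range n).map fun _ => false :=
      Primrec.list_map Primrec.list_range (Primrec.const false).to₂
    refine (h1.to_comp.comp (Primrec.nat_add.to_comp.comp Computable.fst
      (Computable.const 3))).of_eq fun q => ?_
    simp [List.map_const']
  have hP := primrecRel_survivorTest.decide.to_comp.comp ht hv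
  refine (Computable.cond hP hv hz).of_eq fun q => ?_
  rw [Bool.cond_decide]
  rfl

theorem exists_not_wins {A B : BettingStrategy} (hCA : A.IsComputable) (hCB : B.IsComputable)
    (hA : A.IsHalfSplitting) (hB : B.IsHalfSplitting) {π : ℕ → ℕ} (hcπ : Computable π)
    (hπ : Function.Injective π) {g : ℕ → ℕ} (hcg : Computable g) (hgu : ∀ K, ∃ ℓ, K ≤ g ℓ)
    (hgA : A.SplitsUpperBounded π fun ℓ => (ℓ : ℤ) - (g ℓ : ℤ))
    (hgB : B.SplitsUpperBounded π fun ℓ => (ℓ : ℤ) - (g ℓ : ℤ)) :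
    ∃ σ, ¬ IsMartinLofRandom σ ∧ ¬ A.Wins σ ∧ ¬ B.Wins σ := by
  obtain ⟨G₁, hcG₁, hG₁⟩ := BettingStrategy.exists_isPartEnumeration hCA hA
  obtain ⟨G₂, hcG₂, hG₂⟩ := BettingStrategy.exists_isPartEnumeration hCB hB
  obtain ⟨R, L, σ₀, hσ₀⟩ := BettingStrategy.exists_forall_le_fiberCard hA hB hπ hgA hgB
  obtain ⟨lev, hclev, hlevm, hlevL, hlevg⟩ := exists_computable_levels hcg hgu L
  have hglev : ∀ i, g (lev i) ≤ lev i := by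
    intro i
    -- The root part contains the whole fiber, which has only `2 ^ lev i` elements.
    have h := (hσ₀ A (Or.inl rfl) [] (by rw [A.S.eventualPart_nil]; trivial)).2 _ (hlevL i)
    rw [A.S.eventualPart_nil, fiberCard_univ (nodup_block hπ _), length_block] at h
    exact (Nat.pow_le_pow_iff_right (by norm_num)).1 h
  -- One below `g`, so that a part with exactly `2 ^ e i` elements misses the required `2 ^ g (lev
  -- i)`.
  let e : ℕ → ℕ := fun i => g (lev i) - 1
  have he1 : ∀ i, e i + 1 = g (lev i) := fun i => by have := hlevg i; simp only [e]; omega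
  have he : ∀ i, e i < lev i := fun i => by have := he1 i; have := hglev i; omega
  let blk : ℕ → List ℕ := fun i => block π (lev i)
  let thr : ℕ → ℕ := fun i => 2 ^ (e i + 1)
  -- The capitals around `σ₀` are below `R`, and the approximations are off by at most 1.
  let T : ℕ := R + 1
  let D := killEvents T blk thr G₁ G₂
  let W := safeSet T blk thr G₁ G₂
  let U : ℕ → Set BitSeq := fun i => survivorSet (blk i) (2 ^ e i) (D i) (levelString i)
  have hW : ∀ i σ, σ ∈ W i ↔
      ∀ t, killed seqUpdate seqPrefix (blk i) (2 ^ e i) (D i t) σ = false :=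
    fun i σ => mem_safeSet_iff hA hB hG₁ hG₂ hπ he T i
  have hne : (W 0).Nonempty := by
    refine ⟨σ₀, fun C k hC hσC => ?_⟩
    have key : ∀ X ∈ ({A, B} : Set BettingStrategy), ∀ x, listSet C = X.S.eventualPart x →
        |(k : ℝ) - X.capital x| ≤ 1 →
        k < T ∧ ∀ j, thr (0 + j) ≤ fiberCard (blk (0 + j)) (listSet C) σ₀ := by
      intro X hX x hx hk
      rw [hx] at hσC ⊢
      obtain ⟨h1, h2⟩ := hσ₀ X hX x hσC
      refine ⟨?_, fun j => ?_⟩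
      · have h3 : (X.capital x : ℝ) < R := by exact_mod_cast h1
        have h4 := (abs_le.1 hk).2
        have h5 : (k : ℝ) < (R + 1 : ℕ) := by push_cast; linarith
        exact_mod_cast h5
      · simp only [thr, he1]
        exact h2 _ (hlevL _)
    obtain ⟨n, hn | hn⟩ := hC
    · obtain ⟨x, hx, hk⟩ := hG₁.sound n C k hn
      exact key A (Or.inl rfl) x hx hk
    · obtain ⟨x, hx, hk⟩ := hG₂.sound n C k hn
      exact key B (Or.inr rfl) x hx hk
  obtain ⟨σ, hσW, hσU⟩ := exists_mem_closure_frequently (W := W) safeSet_mono hne (U := U)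
    (fun i => isOpen_survivorSet _ _ _ _) (by
      rintro i ⟨τ, hτ, hs⟩
      obtain ⟨τ', h1, h2, h3⟩ := exists_mem_survivorSet
        (fun t t' h => killEvents_subset h) hs ((hW i τ).1 hτ)
      exact ⟨τ', ⟨h1, (hW i τ').2 h3⟩, h2⟩)
  have hbound : ∀ C k, IsEnumerated G₁ G₂ C k → σ ∈ listSet C → k < T := by
    intro C k hC hσC
    -- A part around `σ` is open, so it contains a safe sequence `τ`. The capital bound concerns the
    -- part alone and carries over to `σ`.
    obtain ⟨τ, hτC, hτ⟩ := mem_closure_iff.1 hσW _ (isOpen_listSet C) hσC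
    obtain ⟨i, hi⟩ := Set.mem_iUnion.1 hτ
    exact (hi C k hC hτC).1
  refine ⟨σ, ?_, ?_, ?_⟩
  · let data : ℕ → ℕ → SurvivorData := fun i t => (((blk i, 2 ^ e i), D i t), levelString i)
    have hcblk : Computable blk := (computable_block hcπ).comp hclev
    have hce : Computable e := Computable.pred.comp (hcg.comp hclev)
    have hcthr : Computable thr := primrec_two_pow.to_comp.comp (Computable.succ.comp hce)
    have hcdata : Computable₂ data :=
      ((((hcblk.comp Computable.fst).pair
        (primrec_two_pow.to_comp.comp (hce.comp Computable.fst))).pair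
        (computable_killEvents hcblk hcthr hcG₁ hcG₂)).pair
        (computable_levelString.comp Computable.fst))
    refine not_isMartinLofRandom_of_frequently (computable_levelEnum hcdata) (fun i => ?_)
      (hσU.mono fun i hi => ?_)
    -- The enumeration must be total, so failed tests output a fixed filler string, which adds
    -- measure `2⁻¹ ^ (i + 3)`.
    · have hsub : testLevel (levelEnum data) i ⊆ U i ∪ basicSet (List.replicate (i + 3) false) := by
        refine Set.iUnion_subset fun k => ?_
        rw [levelEnum]
        split_ifs with h
        · exact fun τ hτ => Or.inl ⟨_, h.survivor_eq hτ⟩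
        · exact Set.subset_union_right
      have hUm := measure_survivorSet_le (nodup_block hπ (lev i)) (hA.isDyadicLaminar hπ (lev i))
        (hB.isDyadicLaminar hπ (lev i)) (k := e i) (by rw [length_block]; exact (he i).le)
        (D := D i) (fun t t' h => killEvents_subset h) (fun t ev hev => by
          obtain ⟨n, C, k, -, ⟨j, rfl⟩ | ⟨-, rfl⟩⟩ := mem_killEvents.1 ⟨t, hev⟩
          · exact block_subset (hlevm (Nat.le_add_right i j))
          · exact fun _ h => h) (fun t ev hev => by
          obtain ⟨n, C, k, hG, h⟩ := mem_killEvents.1 ⟨t, hev⟩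
          have h1 : ev.1 = C := by
            rcases h with ⟨j, rfl⟩ | ⟨-, rfl⟩ <;> rfl
          rw [h1]
          rcases hG with hG | hG
          · obtain ⟨x, hx, -⟩ := hG₁.sound n C k hG
            exact Or.inl ⟨x, hx.symm⟩
          · obtain ⟨x, hx, -⟩ := hG₂.sound n C k hG
            exact Or.inr ⟨x, hx.symm⟩) (levelString i)
      have hU3 : uniformMeasure (U i) ≤ (2⁻¹ : ℝ≥0∞) ^ (i + 3) := by
        -- Two of these five powers of two absorb the constant `3 ≤ 2 ^ 2`; the remaining bound `2⁻¹
        -- ^ (i + 3)` is doubled by the filler.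
        have h5 : i + 5 ≤ e i := by have := he1 i; have := hlevg i; omega
        have h6 : uniformMeasure (U i) * 2 ^ (i + 5) ≤ 2 ^ 2 := by
          calc uniformMeasure (U i) * 2 ^ (i + 5) ≤ uniformMeasure (U i) * 2 ^ e i := by
                gcongr
                norm_num
            _ ≤ 3 := hUm
            _ ≤ 2 ^ 2 := by norm_num
        rw [show i + 5 = i + 3 + 2 by ring, pow_add, ← mul_assoc] at h6
        have h7 : uniformMeasure (U i) * 2 ^ (i + 3) ≤ 1 := by
          refine (ENNReal.mul_le_mul_iff_left (c := 2 ^ 2) (by simp) (by finiteness)).1 ?_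
          rwa [one_mul]
        rw [← ENNReal.inv_pow, ← one_div]
        exact (ENNReal.le_div_iff_mul_le (by simp) (by simp)).2 h7
      calc uniformMeasure (testLevel (levelEnum data) i)
          ≤ uniformMeasure (U i) + uniformMeasure (basicSet (List.replicate (i + 3) false)) :=
            (measure_mono hsub).trans (measure_union_le _ _)
        _ ≤ (2⁻¹ : ℝ≥0∞) ^ (i + 3) + 2⁻¹ ^ (i + 3) := by
            rw [measure_basicSet_replicate]
            gcongr
        _ = (2⁻¹ : ℝ≥0∞) ^ (i + 2) := by
            rw [pow_succ _ (i + 2), ← mul_add, ENNReal.inv_two_add_inv_two, mul_one]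
    · obtain ⟨t, ht⟩ := hi
      obtain ⟨M, hM⟩ := exists_survivorTest ht
      refine Set.mem_iUnion.2 ⟨Nat.pair t (Encodable.encode (truncSeq M σ)), ?_⟩
      have hlv : levelString (Nat.pair t (Encodable.encode (truncSeq M σ))).unpair.2 =
          truncSeq M σ := by rw [Nat.unpair_pair, levelString_encode]
      rw [levelEnum, hlv, Nat.unpair_pair, if_pos (hM M le_rfl)]
      exact mem_basicSet_truncSeq M σ
  · refine BettingStrategy.not_wins_of_capital_le (R := T + 1) fun x hx => ?_
    obtain ⟨n, C, k, hn, hC, hk⟩ := hG₁.complete x σ hx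
    have h1 : (k : ℝ) < T := by exact_mod_cast hbound C k ⟨n, Or.inl hn⟩ (hC ▸ hx)
    have h2 := (abs_le.1 hk).1
    rw [← NNReal.coe_le_coe]
    push_cast
    linarith
  · refine BettingStrategy.not_wins_of_capital_le (R := T + 1) fun x hx => ?_
    obtain ⟨n, C, k, hn, hC, hk⟩ := hG₂.complete x σ hx
    have h1 : (k : ℝ) < T := by exact_mod_cast hbound C k ⟨n, Or.inr hn⟩ (hC ▸ hx)
    have h2 := (abs_le.1 hk).1
    rw [← NNReal.coe_le_coe]
    push_cast
    linarith

end Main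

theorem mainTheorem2 :
    (∀ B : BettingStrategy, B.IsKolmogorovLoveland → B.IsHalfSplitting) ∧
    ∀ A B : BettingStrategy, A.IsComputable → B.IsComputable →
      A.IsHalfSplitting → B.IsHalfSplitting →
      ∀ π : ℕ → ℕ, Computable π → Function.Injective π →
      ∀ g : ℕ → ℕ, Computable g → (∀ K : ℕ, ∃ ℓ : ℕ, K ≤ g ℓ) →
      A.SplitsUpperBounded π (fun ℓ => (ℓ : ℤ) - (g ℓ : ℤ)) →
      B.SplitsUpperBounded π (fun ℓ => (ℓ : ℤ) - (g ℓ : ℤ)) →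
      ∃ σ : BitSeq, ¬ IsMartinLofRandom σ ∧ ¬ A.Wins σ ∧ ¬ B.Wins σ :=
  ⟨fun _ hB => hB.isHalfSplitting, fun _ _ hCA hCB hA hB _ hcπ hπ _ hcg hgu hgA hgB =>
    exists_not_wins hCA hCB hA hB hcπ hπ hcg hgu hgA hgB⟩
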